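/- A labeled graph $G$ is a directed graph with finitely many nodes, without loops and without parallel edges, together with an integer label $G(v)$ at every node $v$. It is standard if all labels are nonnegative and $G(a)\le G(b)$ for every edge $(a,b)$. A standard component of $G$ is a labeled graph $H$ with the same nodes and the same edges as $G$ such that all labels of $H$ are $0$ or $1$ and not all of them are $0$, $H$ is standard, and $G-H$ (difference of labels) is standard. A standard decomposition of $G$ is a finite multiset $\mathcal H$ of standard components of $G$ with $G=\sum_{H\in\mathcal H}H$ (sum of labels; the empty sum has all labels $0$). A labeled graph with $n$ nodes and $e$ edges is given as input by the list of its $n$ node labels and a list of its $e$ edges in any order; its size is $n+e$. The output consists of a list of all standard components of $G$, each occurring once and given by one bit per node, followed by a list of all standard decompositions of $G$, each occurring once and given as a list of positions in the list of components. If there are $k$ standard components, the size of the output is $nk+\sum_{\mathcal H}|\mathcal H|$, where the sum is over all standard decompositions $\mathcal H$ of $G$. Labels and indices take one machine word each, and the computation model has unit-cost elementary operations on words (subtraction and comparison of integers, allocating and reading cells of linked lists, function calls). Theorem. All standard decompositions of a labeled graph can be generated in polynomial time: there are a single program and a polynomial $p$ such that, for every labeled graph $G$ and every listing of its edges, the program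 halts on this input with a correct output as above after at most $p(\text{input size}+\text{output size})$ steps. (If $G$ is not standard, the correct output is a pair of empty lists.) -/

import Mathlib

/-! ### Labeled graphs and standard decompositions -/

/-- A labeled graph with node set `V`: a directed graph without loops and without parallel edges,
together with an integer label at each node. -/
@[ext]
structure LabeledGraph (V : Type*) where
  graph : Digraph V
  loopless : ∀ v, ¬ graph.Adj v v
  label : V → ℤ

namespace LabeledGraph

variable {V : Type*}

/-- All labels are nonnegative, and labels do not decrease along edges. -/
def IsStandard (G : LabeledGraph V) : Prop :=
  (∀ v, 0 ≤ G.label v) ∧ ∀ a b, G.graph.Adj a b → G.label a ≤ G.label b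

/-- All labels are `0` or `1`. -/
def IsZeroOne (G : LabeledGraph V) : Prop :=
  ∀ v, G.label v = 0 ∨ G.label v = 1

/-- The difference of two labeled graphs on the same node set: the union of the edge sets,
with the difference of the labelings. -/
instance : Sub (LabeledGraph V) where
  sub G H :=
    { graph := G.graph ⊔ H.graph
      loopless := fun v h => h.elim (G.loopless v) (H.loopless v)
      label := fun v => G.label v - H.label v }

/-- The sum of a multiset of labeled graphs that share the nodes and edges of `G`.
In particular the empty sum is the graph with the nodes and edges of `G` and all labels zero. -/
def sumOn (G : LabeledGraph V) (D : Multiset (LabeledGraph V)) : LabeledGraph V where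
  graph := G.graph
  loopless := G.loopless
  label := fun v => (D.map fun H => H.label v).sum

/-- `H` is a standard component of `G`. Sums and differences are only formed between labeled graphs
that share the same nodes and the same edges, so `H` has the nodes and edges of `G`. -/
structure IsStandardComponent (G H : LabeledGraph V) : Prop where
  graph_eq : H.graph = G.graph
  isZeroOne : H.IsZeroOne
  isStandard : H.IsStandard
  sub_isStandard : (G - H).IsStandard
  ne_zero : ∃ v, H.label v ≠ 0

/-- The set of standard decompositions of `G`: the multisets of standard components of `G` whose
sum is `G`. -/
def decom (G : LabeledGraph V) : Set (Multiset (LabeledGraph V)) :=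
  {D | (∀ H ∈ D, G.IsStandardComponent H) ∧ G.sumOn D = G}

/-- The 0-1 graph with the nodes and edges of `G` whose labels are given by one bit per node. -/
def ofBits (G : LabeledGraph V) (c : V → Bool) : LabeledGraph V where
  graph := G.graph
  loopless := G.loopless
  label := fun v => if c v then 1 else 0

end LabeledGraph

/-! ### A model of computation

First-order recursive programs over words and linked lists. A value is held in one machine word:
it is an integer, or a null pointer, or a pointer to an immutable cell that consists of two values.
A program is a finite list of mutually recursive functions with one argument each. Every evaluation
step performs a bounded number of elementary operations on words (read a variable, allocate or
open one cell, subtract or compare two integers, jump) and costs one unit of time. -/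

/-- Values: integers, the empty list, and cells. -/
inductive Val where
  | int (z : ℤ)
  | nil
  | cons (x y : Val)

/-- Expressions. Variables are numbered from the innermost binding outwards. -/
inductive Expr where
  /-- the value of the variable number `i` -/
  | var (i : ℕ)
  /-- an integer constant -/
  | lit (z : ℤ)
  /-- the empty list -/
  | nil
  /-- allocate a cell -/
  | cons (a b : Expr)
  /-- subtract two integers -/
  | sub (a b : Expr)
  /-- compare two integers: `if a < b then c else d` -/
  | ifLt (a b c d : Expr)
  /-- evaluate `a`, bind a new variable to its value, and continue with `b` -/
  | bind (a b : Expr)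
  /-- evaluate `a`; if the value is the empty list continue with `b`, and if it is a cell, bind
  variable `0` to its first and variable `1` to its second entry and continue with `c` -/
  | split (a b c : Expr)
  /-- call the function number `f` of the program on the value of `a` -/
  | call (f : ℕ) (a : Expr)

/-- A program: the list of the bodies of its functions. -/
abbrev Program := List Expr

/-- `Eval P ρ e v t`: in the program `P`, with the values of the variables given by the list `ρ`, the
evaluation of the expression `e` terminates with value `v` after exactly `t` steps. -/
inductive Eval (P : Program) : List Val → Expr → Val → ℕ → Prop
  | var {ρ i v} : ρ[i]? = some v → Eval P ρ (.var i) v 1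
  | lit {ρ z} : Eval P ρ (.lit z) (.int z) 1
  | nil {ρ} : Eval P ρ .nil .nil 1
  | cons {ρ a b x y s t} : Eval P ρ a x s → Eval P ρ b y t →
      Eval P ρ (.cons a b) (.cons x y) (s + t + 1)
  | sub {ρ a b x y s t} : Eval P ρ a (.int x) s → Eval P ρ b (.int y) t →
      Eval P ρ (.sub a b) (.int (x - y)) (s + t + 1)
  | ifLt_pos {ρ a b c d x y v r s t} : Eval P ρ a (.int x) r → Eval P ρ b (.int y) s → x < y →
      Eval P ρ c v t → Eval P ρ (.ifLt a b c d) v (r + s + t + 1)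
  | ifLt_neg {ρ a b c d x y v r s t} : Eval P ρ a (.int x) r → Eval P ρ b (.int y) s → ¬ x < y →
      Eval P ρ d v t → Eval P ρ (.ifLt a b c d) v (r + s + t + 1)
  | bind {ρ a b x v s t} : Eval P ρ a x s → Eval P (x :: ρ) b v t →
      Eval P ρ (.bind a b) v (s + t + 1)
  | split_nil {ρ a b c v s t} : Eval P ρ a .nil s → Eval P ρ b v t →
      Eval P ρ (.split a b c) v (s + t + 1)
  | split_cons {ρ a b c x y v s t} : Eval P ρ a (.cons x y) s → Eval P (x :: y :: ρ) c v t →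
      Eval P ρ (.split a b c) v (s + t + 1)
  | call {ρ f a body x v s t} : P[f]? = some body → Eval P ρ a x s → Eval P [x] body v t →
      Eval P ρ (.call f a) v (s + t + 1)

/-- Evaluation is deterministic: an expression has at most one value and one running time. -/
theorem Eval.unique {P : Program} {ρ : List Val} {e : Expr} {v w : Val} {s t : ℕ}
    (h : Eval P ρ e v s) (h' : Eval P ρ e w t) : v = w ∧ s = t := by
  induction h generalizing w t <;> cases h' <;> grind

/-- `Runs P x y t`: on input `x`, the program `P` (that is, its function number `0`) halts with
output `y` after exactly `t` steps. -/
def Runs (P : Program) (x y : Val) (t : ℕ) : Prop :=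
  Eval P [x] (.call 0 (.var 0)) y t

/-- A linked list. -/
def Val.ofList : List Val → Val
  | [] => .nil
  | x :: l => .cons x (Val.ofList l)

/-! ### Input and output -/

namespace LabeledGraph

variable {n : ℕ}

/-- `E` lists every edge of `G` exactly once, in some order. -/
def IsEdgeList (G : LabeledGraph (Fin n)) (E : List (Fin n × Fin n)) : Prop :=
  E.Nodup ∧ ∀ a b, (a, b) ∈ E ↔ G.graph.Adj a b

/-- The input: the list of the labels of the nodes `0, …, n - 1`, and the list of the edges, each
edge being a pair of node indices. -/
def input (G : LabeledGraph (Fin n)) (E : List (Fin n × Fin n)) : Val :=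
  .cons (.ofList (List.ofFn fun v => .int (G.label v)))
    (.ofList (E.map fun e => .cons (.int (e.1 : ℕ)) (.int (e.2 : ℕ))))

end LabeledGraph

/-- A list of 0-1 labelings of the nodes `0, …, n - 1`, and a list of multisets of them, each given
as a list of positions in the first list. -/
structure Output (n : ℕ) where
  comps : List (Fin n → Bool)
  decs : List (List (Fin comps.length))

namespace Output

variable {n : ℕ}

/-- The value that represents the output: a list of lists of bits, and a list of lists of indices. -/
def toVal (O : Output n) : Val :=
  .cons (.ofList (O.comps.map fun c => .ofList (List.ofFn fun v => .int (if c v then 1 else 0))))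
    (.ofList (O.decs.map fun D => .ofList (D.map fun i => .int (i : ℕ))))

/-- The size of the output: one unit for each bit of each component, and one unit for each index
in each decomposition. -/
def size (O : Output n) : ℕ :=
  n * O.comps.length + (O.decs.map List.length).sum

/-- The multisets of labeled graphs described by the output, on the nodes and edges of `G`. -/
def multisets (O : Output n) (G : LabeledGraph (Fin n)) :
    List (Multiset (LabeledGraph (Fin n))) :=
  O.decs.map fun D => ↑(D.map fun i => G.ofBits (O.comps.get i))

/-- The output lists every standard component of `G` exactly once and every standard decomposition
of `G` exactly once, and nothing else. -/
structure IsCorrect (O : Output n) (G : LabeledGraph (Fin n)) : Prop where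
  nodup_comps : (O.comps.map G.ofBits).Nodup
  mem_comps : ∀ H, H ∈ O.comps.map G.ofBits ↔ G.IsStandardComponent H
  nodup_decs : (O.multisets G).Nodup
  mem_decs : ∀ D, D ∈ O.multisets G ↔ D ∈ G.decom

end Output

/-! Identify a 0-1 graph with its set of nodes of label 1. If G is standard with labels g, a
nonempty set c is a component exactly when it lies in the support of g and is closed under the edges
and under the reversals of those edges whose ends have equal labels (`good_iff`). These conditions
survive unions and intersections. Hence every component is the union of the least closed sets of its
nodes, and the list of components is built by adjoining one such generator at a time
(`mem_comps_iff`). This list never shrinks, so intermediate lists are bounded by the output.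

For the decompositions, replacing two components c, c' by their union and their intersection
(dropped if empty) preserves the sum. Repeating such exchanges produces, from any nonempty
decomposition, the support of g as one of its members (`exists_sup_cons`). Removing the support and
continuing leads to a decomposition into a chain, which depends on g only (`IsChainOf.addConGen`).
So the graph whose vertices are the decompositions and whose edges are the exchanges, in both
directions, is connected. The chain is easy to compute (`chain_run`), and a graph search from it
reaches every decomposition (`search_run`, `state_mem_of_addConGen`).

A decomposition is stored as its vector of multiplicities. An exchange is a difference of four rows,
one for each set involved, where the empty set serves as a dummy; there are (k+1)^4 such
differences. The rows also carry the labels with both signs, so that nonnegativity of the new vector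
alone certifies that it is again a decomposition (`row_nonneg_iff`, `isDec_of_move`). The search
therefore visits decompositions only.

The time is polynomial in n, e, k, the number N of decompositions and a bound M for labels and
multiplicities. The output size controls the last three: k ≤ nk since there is no component without
nodes; N exceeds the sum of the cardinalities by at most 1, as only one decomposition can be empty;
and labels and multiplicities are at most the largest cardinality of a decomposition. -/

/-! ### Evaluation with a time bound -/

/-- The expression `e` evaluates to `v` in at most `B` steps. -/
def EvalLe (P : Program) (ρ : List Val) (e : Expr) (v : Val) (B : ℕ) : Prop :=
  ∃ t ≤ B, Eval P ρ e v t

namespace EvalLe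

variable {P : Program} {ρ : List Val} {a b c d : Expr} {v w x y : Val} {r s t B : ℕ}

theorem of (h : EvalLe P ρ a v s) (hv : v = w) (hB : s ≤ B) : EvalLe P ρ a w B := by
  obtain ⟨t, ht, h⟩ := h
  exact ⟨t, ht.trans hB, hv ▸ h⟩

theorem var {i : ℕ} (h : ρ[i]? = some v) : EvalLe P ρ (.var i) v 1 := ⟨1, le_rfl, .var h⟩

theorem lit {z : ℤ} : EvalLe P ρ (.lit z) (.int z) 1 := ⟨1, le_rfl, .lit⟩

theorem nil : EvalLe P ρ .nil .nil 1 := ⟨1, le_rfl, .nil⟩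

theorem cons (ha : EvalLe P ρ a x s) (hb : EvalLe P ρ b y t) :
    EvalLe P ρ (.cons a b) (.cons x y) (s + t + 1) := by
  obtain ⟨s', hs, ha⟩ := ha
  obtain ⟨t', ht, hb⟩ := hb
  exact ⟨_, by omega, .cons ha hb⟩

theorem sub {x y : ℤ} (ha : EvalLe P ρ a (.int x) s) (hb : EvalLe P ρ b (.int y) t) :
    EvalLe P ρ (.sub a b) (.int (x - y)) (s + t + 1) := by
  obtain ⟨s', hs, ha⟩ := ha
  obtain ⟨t', ht, hb⟩ := hb
  exact ⟨_, by omega, .sub ha hb⟩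

theorem ifLt_pos {x y : ℤ} (ha : EvalLe P ρ a (.int x) r) (hb : EvalLe P ρ b (.int y) s)
    (h : x < y) (hc : EvalLe P ρ c v t) : EvalLe P ρ (.ifLt a b c d) v (r + s + t + 1) := by
  obtain ⟨r', hr, ha⟩ := ha
  obtain ⟨s', hs, hb⟩ := hb
  obtain ⟨t', ht, hc⟩ := hc
  exact ⟨_, by omega, .ifLt_pos ha hb h hc⟩

theorem ifLt_neg {x y : ℤ} (ha : EvalLe P ρ a (.int x) r) (hb : EvalLe P ρ b (.int y) s)
    (h : ¬ x < y) (hd : EvalLe P ρ d v t) : EvalLe P ρ (.ifLt a b c d) v (r + s + t + 1) := by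
  obtain ⟨r', hr, ha⟩ := ha
  obtain ⟨s', hs, hb⟩ := hb
  obtain ⟨t', ht, hd⟩ := hd
  exact ⟨_, by omega, .ifLt_neg ha hb h hd⟩

/-- The bound pays for both branches, so that time estimates need no case distinction. -/
theorem ifLt {x y : ℤ} {t' : ℕ} (ha : EvalLe P ρ a (.int x) r) (hb : EvalLe P ρ b (.int y) s)
    (hc : EvalLe P ρ c v t) (hd : EvalLe P ρ d w t') :
    EvalLe P ρ (.ifLt a b c d) (if x < y then v else w) (r + s + (t + t') + 1) := by
  split_ifs with h
  · exact (ifLt_pos ha hb h hc).of rfl (by omega)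
  · exact (ifLt_neg ha hb h hd).of rfl (by omega)

theorem test {p : Prop} [Decidable p] {t' : ℕ}
    (ha : EvalLe P ρ a (.int (if p then 1 else 0)) r)
    (hc : EvalLe P ρ c v t) (hd : EvalLe P ρ d w t') :
    EvalLe P ρ (.ifLt (.lit 0) a c d) (if p then v else w) (r + t + t' + 2) := by
  by_cases h : p <;> simp only [h, if_true, if_false] at ha ⊢
  · exact (ifLt_pos lit ha (by decide) hc).of rfl (by omega)
  · exact (ifLt_neg lit ha (by decide) hd).of rfl (by omega)

theorem bind (ha : EvalLe P ρ a x s) (hb : EvalLe P (x :: ρ) b v t) :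
    EvalLe P ρ (.bind a b) v (s + t + 1) := by
  obtain ⟨s', hs, ha⟩ := ha
  obtain ⟨t', ht, hb⟩ := hb
  exact ⟨_, by omega, .bind ha hb⟩

theorem split_nil (ha : EvalLe P ρ a .nil s) (hb : EvalLe P ρ b v t) :
    EvalLe P ρ (.split a b c) v (s + t + 1) := by
  obtain ⟨s', hs, ha⟩ := ha
  obtain ⟨t', ht, hb⟩ := hb
  exact ⟨_, by omega, .split_nil ha hb⟩

theorem split (ha : EvalLe P ρ a (.cons x y) s) (hb : EvalLe P (x :: y :: ρ) c v t) :
    EvalLe P ρ (.split a b c) v (s + t + 1) := by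
  obtain ⟨s', hs, ha⟩ := ha
  obtain ⟨t', ht, hb⟩ := hb
  exact ⟨_, by omega, .split_cons ha hb⟩

end EvalLe

/-- The function number `f` of `P`, called on `x`, returns `v` in at most `B` steps. -/
def FunLe (P : Program) (f : ℕ) (x v : Val) (B : ℕ) : Prop :=
  ∃ body, P[f]? = some body ∧ EvalLe P [x] body v B

theorem FunLe.of {P : Program} {f : ℕ} {x v w : Val} {s B : ℕ} (h : FunLe P f x v s)
    (hv : v = w) (hB : s ≤ B) : FunLe P f x w B := by
  obtain ⟨e, he, h⟩ := h
  exact ⟨e, he, h.of hv hB⟩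

theorem EvalLe.call {P : Program} {ρ : List Val} {f : ℕ} {a : Expr} {x v : Val} {s t : ℕ}
    (h : FunLe P f x v t) (ha : EvalLe P ρ a x s) : EvalLe P ρ (.call f a) v (s + t + 1) := by
  obtain ⟨e, he, t', ht, h⟩ := h
  obtain ⟨s', hs, ha⟩ := ha
  exact ⟨_, by omega, .call he ha h⟩

/-- The body of a function `f` with an argument `(e, l)` that is defined by recursion on the list
`l`: `f (e, []) = base e` and `f (e, x :: l) = step (f (next x l e, l)) x l e`. -/
def recBody (f : ℕ) (base next step : Expr) : Expr :=
  .split (.var 0) .nil (.split (.var 1) base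
    (.bind (.call f (.cons next (.var 1))) step))

theorem FunLe.rec_nil {P : Program} {f : ℕ} {base next step : Expr} {e v : Val} {s : ℕ}
    (hf : P[f]? = some (recBody f base next step))
    (h : EvalLe P [e, .nil, .cons e .nil] base v s) : FunLe P f (.cons e .nil) v (s + 4) :=
  ⟨_, hf, (EvalLe.split (.var rfl) (.split_nil (.var rfl) h)).of rfl (by omega)⟩

theorem FunLe.rec_cons {P : Program} {f : ℕ} {base next step : Expr} {e e' x l v w : Val}
    {r s t : ℕ} (hf : P[f]? = some (recBody f base next step))
    (hn : EvalLe P [x, l, e, .cons x l, .cons e (.cons x l)] next e' r)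
    (hr : FunLe P f (.cons e' l) w s)
    (h : EvalLe P [w, x, l, e, .cons x l, .cons e (.cons x l)] step v t) :
    FunLe P f (.cons e (.cons x l)) v (r + s + t + 8) :=
  ⟨_, hf, (EvalLe.split (.var rfl) (.split (.var rfl)
    (.bind (.call hr (.cons hn (.var rfl))) h))).of rfl (by omega)⟩

/-! ### The program -/

namespace Decomp

open Expr

/-- `(b, a) ↦ a - b` -/
def subBody : Expr :=
  recBody 1 nil (split (var 2) nil (var 1))
    (cons (sub (var 1) (split (var 3) (lit 0) (var 0))) (var 0))

/-- `(nil, a) ↦ [0 ≤ a]` -/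
def nonnegBody : Expr :=
  recBody 2 (lit 1) (var 2) (ifLt (var 1) (lit 0) (lit 0) (var 0))

/-- `(a, b) ↦ [a = b]` -/
def eqBody : Expr :=
  split (var 0) nil
    (ifLt (lit 0) (call 2 (cons nil (call 1 (cons (var 1) (var 0)))))
      (call 2 (cons nil (call 1 (cons (var 0) (var 1))))) (lit 0))

/-- `(x, L) ↦ [x ∈ L]` -/
def memBody : Expr :=
  recBody 4 (lit 0) (var 2) (ifLt (lit 0) (call 3 (cons (var 3) (var 1))) (lit 1) (var 0))

/-- `(i, l) ↦ l[i]` -/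
def nthBody : Expr :=
  recBody 5 (lit 0) (sub (var 2) (lit 1)) (ifLt (lit 0) (var 3) (var 0) (var 1))

/-- `(labels, edges) ↦ [the labeled graph is standard]` -/
def stdBody : Expr :=
  recBody 6 (call 2 (cons nil (var 0))) (var 2)
    (split (var 1) nil
      (ifLt (call 5 (cons (var 1) (var 5))) (call 5 (cons (var 0) (var 5))) (lit 0) (var 2)))

/-- `(i, l) ↦` the unit vector number `i`, of the same length as `l` -/
def unitBody : Expr :=
  recBody 7 nil (sub (var 2) (lit 1))
    (cons (ifLt (var 3) (lit 0) (lit 0) (ifLt (lit 0) (var 3) (lit 0) (lit 1))) (var 0))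

/-- `((i, k), l) ↦` the unit vectors from number `i` on, one for each entry of `l` -/
def unitsBody : Expr :=
  recBody 8 nil (split (var 2) nil (cons (sub (var 0) (lit (-1))) (var 1)))
    (cons (call 7 (var 3)) (var 0))

/-- `(b, a) ↦ a ∪ b` -/
def unionBody : Expr :=
  recBody 9 nil (split (var 2) nil (var 1))
    (cons (ifLt (lit 0) (var 1) (lit 1) (split (var 3) (lit 0) (var 0))) (var 0))

/-- `((a, u), U) ↦` the sets of `U`, where `u` is added to those that contain `a` -/
def addBody : Expr :=
  recBody 10 nil (var 2)
    (split (var 3) nil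
      (cons (ifLt (lit 0) (call 5 (cons (var 0) (var 3))) (call 9 (cons (var 1) (var 3))) (var 3))
        (var 2)))

/-- `(labels, edges) ↦` for each node the least set that contains it and is closed under the edges,
and under the reversed edges between nodes of equal label -/
def closureBody : Expr :=
  recBody 11 (call 8 (cons (cons (lit 0) (var 0)) (var 0))) (var 2)
    (bind (call 26 (cons (var 1) (var 0)))
      (split (var 2) nil
        (ifLt (call 5 (cons (var 0) (var 6))) (call 5 (cons (var 1) (var 6))) (var 2)
          (call 26 (cons (cons (var 1) (var 0)) (var 2))))))

/-- `((u, L), L) ↦ L ∪ {u} ∪ {s ∪ u : s ∈ L}` -/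
def extendBody : Expr :=
  recBody 12
    (split (var 0) nil
      (ifLt (lit 0) (call 4 (cons (var 0) (var 1))) (var 1) (cons (var 0) (var 1))))
    (var 2)
    (split (var 3) nil (bind (call 9 (cons (var 0) (var 3)))
      (ifLt (lit 0) (call 4 (cons (var 0) (var 3))) (var 3) (cons (var 0) (var 3)))))

/-- `(labels, U) ↦` all unions of sets of `U` that are contained in the support of the labels -/
def compsBody : Expr :=
  recBody 13 nil (var 2)
    (ifLt (lit 0) (call 2 (cons nil (call 1 (cons (var 1) (var 3)))))
      (call 12 (cons (cons (var 1) (var 0)) (var 0))) (var 0))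

/-- `(b, a) ↦ -a ++ b` -/
def negAppendBody : Expr :=
  recBody 14 (var 0) (var 2) (cons (sub (lit 0) (var 1)) (var 0))

/-- `((c, t), C) ↦` the vector with entries `-[c = c']` for `c'` in `C`, followed by `-t` and `t` -/
def rowBody : Expr :=
  recBody 15 (split (var 0) nil (call 14 (cons (var 1) (var 1)))) (var 2)
    (split (var 3) nil
      (cons (ifLt (lit 0) (call 3 (cons (var 3) (var 0))) (lit (-1)) (lit 0)) (var 2)))

/-- `(C, L) ↦` the rows of the elements of `L` -/
def rowsBody : Expr :=
  recBody 16 nil (var 2) (cons (call 15 (cons (cons (var 1) (var 1)) (var 3))) (var 0))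

/-- `((a, acc), B) ↦` the differences `a - b` for `b` in `B`, followed by `acc` -/
def subAllBody : Expr :=
  recBody 17 (split (var 0) nil (var 1)) (var 2)
    (split (var 3) nil (cons (call 1 (cons (var 3) (var 0))) (var 2)))

/-- `(B, A) ↦` the differences `a - b` for `a` in `A` and `b` in `B` -/
def diffsBody : Expr :=
  recBody 18 nil (var 2) (call 17 (cons (cons (var 1) (var 0)) (var 3)))

/-- `((s, todo, seen), moves) ↦ (todo', seen')`, with the new neighbours of `s` added -/
def expandBody : Expr :=
  recBody 19 (split (var 0) nil (var 1)) (var 2)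
    (split (var 3) nil (bind (call 1 (cons (var 3) (var 0)))
      (ifLt (lit 0) (call 2 (cons nil (var 0)))
        (split (var 3) nil
          (ifLt (lit 0) (call 4 (cons (var 2) (var 1))) (var 5)
            (cons (cons (var 2) (var 0)) (cons (var 2) (var 1)))))
        (var 3))))

/-- `(moves, todo, seen) ↦` everything that can be reached -/
def searchBody : Expr :=
  split (var 0) nil (split (var 1) nil (split (var 0) (var 1)
    (call 20 (cons (var 4) (call 19 (cons (cons (var 0) (cons (var 1) (var 3))) (var 4)))))))

/-- `(nil, a) ↦` the support of `a` -/
def supportBody : Expr :=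
  recBody 21 nil (var 2) (cons (ifLt (lit 0) (var 1) (lit 1) (lit 0)) (var 0))

/-- `((C, labels), a) ↦` the decomposition of `a` into a chain -/
def chainBody : Expr :=
  split (var 0) nil (split (var 0) nil
    (ifLt (lit 0) (call 2 (cons nil (call 14 (cons nil (var 3)))))
      (call 15 (cons (cons (var 3) (var 1)) (var 0)))
      (bind (call 21 (cons nil (var 3)))
        (call 1 (cons (call 15 (cons (cons (var 0) (var 0)) (var 1)))
          (call 22 (cons (var 3) (call 1 (cons (var 0) (var 4))))))))))

/-- `(m, i, l) ↦` the list `l` with `m` copies of `i` in front -/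
def repeatBody : Expr :=
  split (var 0) nil (split (var 1) nil
    (ifLt (lit 0) (var 2)
      (cons (var 0) (call 23 (cons (sub (var 2) (lit 1)) (cons (var 0) (var 1))))) (var 1)))

/-- `(i, a) ↦` the list with `a[j]` copies of `i + j` for each `j` -/
def indicesBody : Expr :=
  recBody 24 nil (sub (var 2) (lit (-1))) (call 23 (cons (var 1) (cons (var 3) (var 0))))

/-- `(nil, L) ↦` the index lists of the vectors in `L` -/
def allIndicesBody : Expr :=
  recBody 25 nil (var 2) (cons (call 24 (cons (lit 0) (var 1))) (var 0))

/-- `((a, b), U) ↦` the sets of `U` after a new edge from `a` to `b` -/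
def addEdgeBody : Expr :=
  split (var 0) nil (split (var 0) nil
    (call 10 (cons (cons (var 0) (call 5 (cons (var 1) (var 3)))) (var 3))))

/-- The unit vector number -1 is the zero vector, that is, the empty set. It joins the components as
a dummy, so that exchanges of disjoint sets are differences of four rows as well. Taking all
differences twice yields the moves. -/
def mainBody : Expr :=
  split (var 0) nil
    (ifLt (lit 0) (call 6 (cons (var 0) (var 1)))
      (bind (call 13 (cons (var 0) (call 11 (cons (var 0) (var 1)))))
      (bind (call 16 (cons (var 0) (cons (call 7 (cons (lit (-1)) (var 1))) (var 0))))
      (bind (call 18 (cons (var 0) (var 0)))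
      (bind (call 18 (cons (var 0) (var 0)))
      (bind (call 22 (cons (cons (var 3) (var 4)) (var 4)))
      (cons (var 4) (call 25 (cons nil
        (call 20 (cons (var 1) (cons (cons (var 0) nil) (cons (var 0) nil))))))))))))
      (cons nil nil))

/-- The order fixes the function numbers used in `call`. -/
def prog : Program :=
  [mainBody, subBody, nonnegBody, eqBody, memBody, nthBody, stdBody, unitBody, unitsBody,
    unionBody, addBody, closureBody, extendBody, compsBody, negAppendBody, rowBody, rowsBody,
    subAllBody, diffsBody, expandBody, searchBody, supportBody, chainBody, repeatBody,
    indicesBody, allIndicesBody, addEdgeBody]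

/-! ### Vectors of integers -/

def vec (l : List ℤ) : Val := .ofList (l.map .int)

def mat (L : List (List ℤ)) : Val := .ofList (L.map vec)

/-- The time for a pass over a vector of length at most `m`. -/
def tVec (m : ℕ) : ℕ := (m + 1) * 40

theorem tVec_mono {m m' : ℕ} (h : m ≤ m') : tVec m ≤ tVec m' := by
  unfold tVec; omega

def vsub (a b : List ℤ) : List ℤ := List.zipWith (· - ·) a b

theorem length_vsub {a b : List ℤ} (h : a.length = b.length) :
    (vsub a b).length = a.length := by simp [vsub, h]

theorem sub_run : ∀ (a b : List ℤ), a.length = b.length →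
    FunLe prog 1 (.cons (vec b) (vec a)) (vec (vsub a b)) (tVec a.length)
  | [], b, _ => (FunLe.rec_nil rfl .nil).of rfl (by unfold tVec; omega)
  | x :: a, y :: b, h =>
    (FunLe.rec_cons rfl (.split (.var rfl) (.var rfl)) (sub_run a b (by simpa using h))
      (.cons (.sub (.var rfl) (.split (.var rfl) (.var rfl))) (.var rfl))).of rfl
      (by simp only [tVec, List.length_cons]; omega)

theorem nonneg_run : ∀ (a : List ℤ), FunLe prog 2 (.cons .nil (vec a))
    (.int (if ∀ x ∈ a, 0 ≤ x then 1 else 0)) (tVec a.length)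
  | [] => (FunLe.rec_nil rfl .lit).of (by simp) (by unfold tVec; omega)
  | x :: a =>
    (FunLe.rec_cons rfl (.var rfl) (nonneg_run a)
      (.ifLt (.var rfl) .lit .lit (.var rfl))).of
      (by
        by_cases h : x < 0
        · simp [h]
        · have h' : 0 ≤ x := not_lt.mp h
          simp only [h, if_false, List.forall_mem_cons, h', true_and])
      (by simp only [tVec, List.length_cons]; omega)

/-- Antisymmetry of the order: this turns an equality test into subtractions and comparisons. -/
theorem nonneg_vsub_iff : ∀ (a b : List ℤ), a.length = b.length →
    (((∀ x ∈ vsub a b, 0 ≤ x) ∧ ∀ x ∈ vsub b a, 0 ≤ x) ↔ a = b)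
  | [], [], _ => by simp [vsub]
  | x :: a, y :: b, h => by
    have := nonneg_vsub_iff a b (by simpa using h)
    simp only [vsub, List.zipWith_cons_cons, List.mem_cons, forall_eq_or_imp, List.cons.injEq]
      at this ⊢
    rw [← this, show x = y ↔ 0 ≤ x - y ∧ 0 ≤ y - x by omega]
    tauto

def tEq (m : ℕ) : ℕ := 4 * tVec m + 30

theorem eq_run (a b : List ℤ) (h : a.length = b.length) :
    FunLe prog 3 (.cons (vec a) (vec b)) (.int (if a = b then 1 else 0)) (tEq a.length) :=
  ⟨_, rfl, (EvalLe.split (.var rfl)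
    (.test (.call (nonneg_run _) (.cons .nil (.call (sub_run a b h) (.cons (.var rfl) (.var rfl)))))
      (.call (nonneg_run _) (.cons .nil (.call (sub_run b a h.symm) (.cons (.var rfl) (.var rfl)))))
      .lit)).of
    (by
      simp only [← nonneg_vsub_iff a b h, ite_and]
      split_ifs <;> rfl)
    (by rw [length_vsub h, length_vsub h.symm, ← h]; unfold tEq; omega)⟩

def tMem (N m : ℕ) : ℕ := (N + 1) * (tEq m + 30)

theorem tMem_mono {N N' m m' : ℕ} (h : N ≤ N') (h' : m ≤ m') : tMem N m ≤ tMem N' m' := by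
  have := tVec_mono h'
  unfold tMem tEq; gcongr

theorem mem_run (x : List ℤ) : ∀ (L : List (List ℤ)), (∀ y ∈ L, y.length = x.length) →
    FunLe prog 4 (.cons (vec x) (mat L)) (.int (if x ∈ L then 1 else 0))
      (tMem L.length x.length)
  | [], _ => (FunLe.rec_nil rfl .lit).of (by simp) (by simp only [tMem, List.length_nil]; omega)
  | y :: L, h =>
    (FunLe.rec_cons rfl (.var rfl) (mem_run x L fun z hz => h z (by simp [hz]))
      (.test (.call (eq_run x y (h y (by simp)).symm) (.cons (.var rfl) (.var rfl)))
        .lit (.var rfl))).of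
      (by
        by_cases h : x = y <;> simp [h])
      -- Splitting off one summand of the product leaves an inequality that is linear in the
      -- remaining products; the same device serves all recursions below.
      (by simp only [tMem, List.length_cons, Nat.succ_mul (L.length + 1)]; omega)

/-- The program descends to the end of the list even after the index is used up, so negative indices
and an arbitrary default on the empty list are needed. -/
def nthVal : ℤ → List Val → Val
  | _, [] => .int 0
  | z, x :: l => if 0 < z then nthVal (z - 1) l else x

theorem nthVal_natCast : ∀ (i : ℕ) (l : List Val) (h : i < l.length), nthVal i l = l[i]
  | 0, x :: l, _ => by simp [nthVal]
  | i + 1, x :: l, h => by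
    have := nthVal_natCast i l (by simpa using h)
    simp [nthVal, this]

theorem nthVal_run : ∀ (z : ℤ) (l : List Val),
    FunLe prog 5 (.cons (.int z) (.ofList l)) (nthVal z l) (tVec l.length)
  | _, [] => (FunLe.rec_nil rfl .lit).of rfl (by unfold tVec; omega)
  | z, x :: l =>
    (FunLe.rec_cons rfl (.sub (.var rfl) .lit) (nthVal_run (z - 1) l)
      (.ifLt .lit (.var rfl) (.var rfl) (.var rfl))).of rfl
      (by simp only [tVec, List.length_cons]; omega)

theorem nth_run {i : ℕ} {l : List Val} (h : i < l.length) :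
    FunLe prog 5 (.cons (.int i) (.ofList l)) l[i] (tVec l.length) :=
  (nthVal_run i l).of (nthVal_natCast i l h) le_rfl

theorem unit_run : ∀ (z : ℤ) (l : List Val),
    FunLe prog 7 (.cons (.int z) (.ofList l))
      (vec (List.ofFn fun j : Fin l.length => if (j : ℤ) = z then 1 else 0)) (tVec l.length)
  | _, [] => (FunLe.rec_nil rfl .nil).of rfl (by unfold tVec; omega)
  | z, x :: l =>
    (FunLe.rec_cons rfl (.sub (.var rfl) .lit) (unit_run (z - 1) l)
      (.cons (.ifLt (.var rfl) .lit .lit (.ifLt .lit (.var rfl) .lit .lit)) (.var rfl))).of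
      (by
        simp only [List.length_cons, List.ofFn_succ, vec, List.map_cons, Val.ofList]
        congr 1
        · rcases lt_trichotomy z 0 with h | h | h
          · simp [h, h.ne']
          · simp [h]
          · simp [h, h.ne]
        · simp [eq_sub_iff_add_eq])
      (by simp only [tVec, List.length_cons]; omega)

theorem negAppend_run (b : List ℤ) : ∀ (a : List ℤ),
    FunLe prog 14 (.cons (vec b) (vec a)) (vec (a.map (- ·) ++ b)) (tVec a.length)
  | [] => (FunLe.rec_nil rfl (.var rfl)).of rfl (by unfold tVec; omega)
  | x :: a =>
    (FunLe.rec_cons rfl (.var rfl) (negAppend_run b a)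
      (.cons (.sub .lit (.var rfl)) (.var rfl))).of (by simp [vec, Val.ofList])
      (by simp only [tVec, List.length_cons]; omega)

theorem support_run : ∀ (a : List ℤ),
    FunLe prog 21 (.cons .nil (vec a)) (vec (a.map fun x => if 0 < x then 1 else 0))
      (tVec a.length)
  | [] => (FunLe.rec_nil rfl .nil).of rfl (by unfold tVec; omega)
  | x :: a =>
    (FunLe.rec_cons rfl (.var rfl) (support_run a)
      (.cons (.ifLt .lit (.var rfl) .lit .lit) (.var rfl))).of
      (by simp only [vec, List.map_cons, Val.ofList]; split_ifs <;> rfl)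
      (by simp only [tVec, List.length_cons]; omega)

/-! ### Sets of nodes -/

variable {n : ℕ}

/-- The characteristic vector of a set of nodes. -/
def bits (c : Fin n → Bool) : List ℤ := List.ofFn fun v => if c v then 1 else 0

@[simp] theorem length_bits (c : Fin n → Bool) : (bits c).length = n := by simp [bits]

theorem bits_injective : Function.Injective (bits (n := n)) := by
  intro c c' h
  have h := List.ofFn_injective h
  funext v
  have := congrFun h v
  cases hc : c v <;> cases hc' : c' v <;> simp_all

theorem bits_mem_map {c : Fin n → Bool} {L : List (Fin n → Bool)} :
    bits c ∈ L.map bits ↔ c ∈ L := by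
  simp [bits_injective.eq_iff]

def edges (E : List (Fin n × Fin n)) : Val :=
  .ofList (E.map fun e => .cons (.int (e.1 : ℕ)) (.int (e.2 : ℕ)))

theorem label_run (g : Fin n → ℤ) (v : Fin n) :
    FunLe prog 5 (.cons (.int (v : ℕ)) (vec (List.ofFn g))) (.int (g v)) (tVec n) :=
  (nth_run (i := v) (l := (List.ofFn g).map .int) (by simp)).of (by simp) (by simp)

theorem bit_run (c : Fin n → Bool) (v : Fin n) :
    FunLe prog 5 (.cons (.int (v : ℕ)) (vec (bits c))) (.int (if c v then 1 else 0)) (tVec n) :=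
  label_run _ v

theorem std_run (g : Fin n → ℤ) : ∀ (E : List (Fin n × Fin n)),
    FunLe prog 6 (.cons (vec (List.ofFn g)) (edges E))
      (.int (if (∀ v, 0 ≤ g v) ∧ ∀ e ∈ E, g e.1 ≤ g e.2 then 1 else 0))
      ((E.length + 1) * (2 * tVec n + 40))
  | [] => (FunLe.rec_nil rfl (.call (nonneg_run _) (.cons .nil (.var rfl)))).of
      (by simp [List.mem_ofFn]) (by simp; omega)
  | e :: E =>
    (FunLe.rec_cons rfl (.var rfl) (std_run g E)
      (.split (.var rfl) (.ifLt (.call (label_run g e.2) (.cons (.var rfl) (.var rfl)))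
        (.call (label_run g e.1) (.cons (.var rfl) (.var rfl))) .lit (.var rfl)))).of
      (by
        by_cases h : g e.2 < g e.1
        · simp [h]
        · have h' : g e.1 ≤ g e.2 := not_lt.mp h
          simp only [h, if_false, List.forall_mem_cons, h', true_and])
      (by rw [List.length_cons, Nat.succ_mul (E.length + 1)]; omega)

theorem units_run (g : List ℤ) : ∀ (z : ℤ) (l : List Val),
    FunLe prog 8 (.cons (.cons (.int z) (vec g)) (.ofList l))
      (mat (List.ofFn fun j : Fin l.length => List.ofFn fun w : Fin g.length =>
        if (w : ℤ) = z + j then 1 else 0)) ((l.length + 1) * (tVec g.length + 40))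
  | _, [] => (FunLe.rec_nil rfl .nil).of rfl (by simp)
  | z, x :: l =>
    (FunLe.rec_cons rfl (.split (.var rfl) (.cons (.sub (.var rfl) .lit) (.var rfl)))
      (units_run g (z + 1) l) (.cons (.call (unit_run z (g.map .int)) (.var rfl)) (.var rfl))).of
      (by
        simp only [List.length_cons, List.ofFn_succ, mat, List.map_cons, Val.ofList]
        congr 1
        · simp
        · simp [fun j : ℤ => show z + 1 + j = z + (j + 1) by ring])
      (by rw [List.length_cons, Nat.succ_mul (l.length + 1), List.length_map]; omega)

theorem union_run : ∀ {n : ℕ} (c c' : Fin n → Bool),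
    FunLe prog 9 (.cons (vec (bits c')) (vec (bits c))) (vec (bits (c ⊔ c'))) (tVec n)
  | 0, c, c' => (FunLe.rec_nil rfl .nil).of rfl (by unfold tVec; omega)
  | n + 1, c, c' => by
    have ih := union_run (fun i : Fin n => c i.succ) (fun i => c' i.succ)
    simp only [bits, List.ofFn_succ] at ih ⊢
    exact (FunLe.rec_cons rfl (.split (.var rfl) (.var rfl)) ih
      (.cons (.test (.var rfl) .lit (.split (.var rfl) (.var rfl))) (.var rfl))).of
      (by
        simp only [vec, List.map_cons, Val.ofList, Pi.sup_apply]
        congr 1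
        by_cases h : c 0 = true <;> by_cases h' : c' 0 = true <;> simp [h, h'])
      (by unfold tVec; omega)

/-! ### Closing sets of nodes under edges -/

def tAdd (k n : ℕ) : ℕ := (k + 1) * (2 * tVec n + 60)

theorem add_run (a : Fin n) (u : Fin n → Bool) : ∀ (L : List (Fin n → Bool)),
    FunLe prog 10 (.cons (.cons (.int (a : ℕ)) (vec (bits u))) (mat (L.map bits)))
      (mat ((L.map fun s => if s a then s ⊔ u else s).map bits)) (tAdd L.length n)
  | [] => (FunLe.rec_nil rfl .nil).of rfl (by simp [tAdd])
  | s :: L =>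
    (FunLe.rec_cons rfl (.var rfl) (add_run a u L)
      (.split (.var rfl) (.cons (.test (.call (bit_run s a) (.cons (.var rfl) (.var rfl)))
        (.call (union_run s u) (.cons (.var rfl) (.var rfl))) (.var rfl)) (.var rfl)))).of
      (by
        simp only [mat, List.map_cons, Val.ofList]
        split_ifs <;> rfl)
      (by simp only [tAdd]; rw [List.length_cons, Nat.succ_mul (L.length + 1)]; omega)

/-- The smallest sets that contain the nodes, after a new edge from `a` to `b`. -/
def addEdge (U : Fin n → Fin n → Bool) (a b : Fin n) : Fin n → Fin n → Bool :=
  fun v => if U v a then U v ⊔ U b else U v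

def sets (U : Fin n → Fin n → Bool) : Val := mat ((List.ofFn U).map bits)

theorem addEdge_run (U : Fin n → Fin n → Bool) (a b : Fin n) :
    FunLe prog 26 (.cons (.cons (.int (a : ℕ)) (.int (b : ℕ))) (sets U)) (sets (addEdge U a b))
      (tAdd n n + tVec n + 30) := by
  have hb : FunLe prog 5 (.cons (.int (b : ℕ)) (sets U)) (vec (bits (U b))) (tVec n) :=
    (nth_run (i := b) (l := ((List.ofFn U).map bits).map vec) (by simp)).of (by simp) (by simp)
  exact ⟨_, rfl, (EvalLe.split (.var rfl) (.split (.var rfl) (.call (add_run a (U b) (List.ofFn U))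
    (.cons (.cons (.var rfl) (.call hb (.cons (.var rfl) (.var rfl)))) (.var rfl))))).of
    (by simp only [sets, List.map_ofFn]; rfl) (by rw [List.length_ofFn]; omega)⟩

/-- For each node the least set that contains it and is closed under the edges in `E`, and under
the reversed edges between nodes of equal label. -/
def closures (g : Fin n → ℤ) : List (Fin n × Fin n) → Fin n → Fin n → Bool
  | [] => fun v w => decide (w = v)
  | e :: E => if g e.1 < g e.2 then addEdge (closures g E) e.1 e.2
    else addEdge (addEdge (closures g E) e.1 e.2) e.2 e.1

def tClosures (e n : ℕ) : ℕ :=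
  (e + 1) * (2 * tAdd n n + 5 * tVec n + 100 + (n + 1) * (tVec n + 40))

theorem closures_run (g : Fin n → ℤ) : ∀ (E : List (Fin n × Fin n)),
    FunLe prog 11 (.cons (vec (List.ofFn g)) (edges E)) (sets (closures g E))
      (tClosures E.length n)
  | [] => by
    have h := units_run (List.ofFn g) 0 ((List.ofFn g).map .int)
    refine (FunLe.rec_nil rfl (.call h (.cons (.cons .lit (.var rfl)) (.var rfl)))).of ?_
      (by simp [tClosures]; omega)
    simp only [sets, List.map_ofFn, closures]
    congr 1
    apply List.ext_getElem
    · simp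
    · intro i h1 h2
      simp only [List.getElem_ofFn, Function.comp, bits]
      apply List.ext_getElem
      · simp
      · intro j h3 h4
        simp [Fin.ext_iff]
  | e :: E =>
    (FunLe.rec_cons rfl (.var rfl) (closures_run g E)
      (.bind (.call (addEdge_run _ e.1 e.2) (.cons (.var rfl) (.var rfl)))
        (.split (.var rfl) (.ifLt (.call (label_run g e.1) (.cons (.var rfl) (.var rfl)))
          (.call (label_run g e.2) (.cons (.var rfl) (.var rfl))) (.var rfl)
          (.call (addEdge_run _ e.2 e.1) (.cons (.cons (.var rfl) (.var rfl)) (.var rfl))))))).of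
      (by simp only [closures]; split_ifs <;> rfl)
      (by simp only [tClosures]; rw [List.length_cons, Nat.succ_mul (E.length + 1)]; omega)

/-- The sets in `L₀`, the set `u`, and the unions of `u` with the sets in `L`. -/
def extend (u : Fin n → Bool) (L₀ : List (Fin n → Bool)) : List (Fin n → Bool) →
    List (Fin n → Bool)
  | [] => if u ∈ L₀ then L₀ else u :: L₀
  | s :: L => if s ⊔ u ∈ extend u L₀ L then extend u L₀ L else (s ⊔ u) :: extend u L₀ L

/-- Since the list only grows, every membership test takes place in a list no longer than the final
list of components. This is what bounds the time by the output. -/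
theorem length_le_extend (u : Fin n → Bool) (L₀ : List (Fin n → Bool)) :
    ∀ L, L₀.length ≤ (extend u L₀ L).length
  | [] => by unfold extend; split_ifs <;> simp
  | s :: L => by
    have := length_le_extend u L₀ L
    unfold extend; split_ifs
    · exact this
    · simp; omega

def tExtend (k n : ℕ) : ℕ := (k + 1) * (tMem k n + tVec n + 60)

theorem mem_bits_run (c : Fin n → Bool) (L : List (Fin n → Bool)) :
    FunLe prog 4 (.cons (vec (bits c)) (mat (L.map bits))) (.int (if c ∈ L then 1 else 0))
      (tMem L.length n) :=
  (mem_run (bits c) (L.map bits) (by simp)).of (by simp only [bits_mem_map]) (by simp)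

theorem extend_run {k : ℕ} (u : Fin n → Bool) (L₀ : List (Fin n → Bool)) :
    ∀ (L : List (Fin n → Bool)), (extend u L₀ L).length ≤ k →
    FunLe prog 12 (.cons (.cons (vec (bits u)) (mat (L₀.map bits))) (mat (L.map bits)))
      (mat ((extend u L₀ L).map bits)) ((L.length + 1) * (tMem k n + tVec n + 60))
  | [], h => by
    have := tMem_mono ((length_le_extend u L₀ []).trans h) le_rfl (m := n)
    exact (FunLe.rec_nil rfl (.split (.var rfl) (.test (.call (mem_bits_run u L₀)
      (.cons (.var rfl) (.var rfl))) (.var rfl) (.cons (.var rfl) (.var rfl))))).of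
      (by simp only [extend]; split_ifs <;> rfl) (by rw [List.length_nil]; omega)
  | s :: L, h => by
    have h' : (extend u L₀ L).length ≤ k := by
      refine le_trans ?_ h
      simp only [extend]; split_ifs <;> simp
    have := tMem_mono h' le_rfl (m := n)
    exact (FunLe.rec_cons rfl (.var rfl) (extend_run u L₀ L h')
      (.split (.var rfl) (.bind (.call (union_run s u) (.cons (.var rfl) (.var rfl)))
        (.test (.call (mem_bits_run (s ⊔ u) _) (.cons (.var rfl) (.var rfl))) (.var rfl)
          (.cons (.var rfl) (.var rfl)))))).of
      (by simp only [extend]; split_ifs <;> rfl)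
      (by rw [List.length_cons, Nat.succ_mul (L.length + 1)]; omega)

/-- All unions of nonempty families of those sets in `U` that are contained in the support of
`g`. -/
def comps (g : Fin n → ℤ) : List (Fin n → Bool) → List (Fin n → Bool)
  | [] => []
  | u :: U => if ∀ v, (if u v then 1 else 0) ≤ g v then extend u (comps g U) (comps g U)
    else comps g U

theorem nonneg_sub_bits (g : Fin n → ℤ) (u : Fin n → Bool) :
    (∀ x ∈ vsub (List.ofFn g) (bits u), 0 ≤ x) ↔ ∀ v, (if u v then 1 else 0) ≤ g v := by
  simp only [List.forall_mem_iff_getElem, vsub, bits]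
  simp [Fin.forall_iff]

def tComps (k n : ℕ) : ℕ := (n + 1) * (tExtend k n + 2 * tVec n + 60)

theorem comps_run {k : ℕ} (g : Fin n → ℤ) : ∀ (U : List (Fin n → Bool)), (comps g U).length ≤ k →
    FunLe prog 13 (.cons (vec (List.ofFn g)) (mat (U.map bits)))
      (mat ((comps g U).map bits)) ((U.length + 1) * (tExtend k n + 2 * tVec n + 60))
  | [], _ => (FunLe.rec_nil rfl .nil).of rfl (by simp)
  | u :: U, h => by
    have h' : (comps g U).length ≤ k := by
      refine le_trans ?_ h
      simp only [comps]; split_ifs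
      · exact length_le_extend ..
      · rfl
    have hl : (List.ofFn g).length = (bits u).length := by simp
    have hs := (sub_run (List.ofFn g) (bits u) hl).of rfl (by rw [List.length_ofFn])
    have hn := (nonneg_run (vsub (List.ofFn g) (bits u))).of
      (by rw [if_congr (nonneg_sub_bits g u) rfl rfl])
      (by rw [length_vsub hl, List.length_ofFn])
    -- The test is evaluated before the case distinction, in the explicit environment of the
    -- recursive step: the result for the tail, `u`, the tail, the labels.
    have hc := EvalLe.call hn (ρ := [mat ((comps g U).map bits), vec (bits u), mat (U.map bits),
      vec (List.ofFn g), mat ((u :: U).map bits),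
      .cons (vec (List.ofFn g)) (mat ((u :: U).map bits))])
      (.cons .nil (.call hs (.cons (.var (i := 1) rfl) (.var (i := 3) rfl))))
    refine (FunLe.rec_cons rfl (.var rfl) (comps_run g U h')
      (t := 2 * tVec n + 40 + tExtend k n) ?_).of rfl
      (by rw [List.length_cons, Nat.succ_mul (U.length + 1)]; omega)
    by_cases hu : ∀ v, (if u v then 1 else 0) ≤ g v
    · simp only [hu, if_true, implies_true, comps] at hc h ⊢
      have he := extend_run u (comps g U) (comps g U) h
      refine (EvalLe.ifLt_pos .lit hc one_pos (.call he
        (.cons (.cons (.var rfl) (.var rfl)) (.var rfl)))).of rfl ?_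
      have : ((comps g U).length + 1) * (tMem k n + tVec n + 60) ≤ tExtend k n := by
        unfold tExtend; gcongr
      omega
    · simp only [hu, if_false, comps] at hc ⊢
      exact (EvalLe.ifLt_neg .lit hc (by decide) (.var rfl)).of rfl (by omega)

/-! ### Vectors of multiplicities -/

/-- The multiplicities `d` of the sets in `C`, followed by the vectors `-t` and `t`. -/
def row (C : List (Fin n → Bool)) (d : (Fin n → Bool) → ℤ) (t : Fin n → ℤ) : List ℤ :=
  C.map d ++ ((List.ofFn t).map (- ·) ++ List.ofFn t)

@[simp] theorem length_row (C : List (Fin n → Bool)) (d t) :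
    (row C d t).length = C.length + 2 * n := by
  simp [row]; omega

/-- Minus the unit vector of `c`. -/
def negUnit (c : Fin n → Bool) : (Fin n → Bool) → ℤ := fun c' => if c = c' then -1 else 0

def bitFun (c : Fin n → Bool) : Fin n → ℤ := fun v => if c v then 1 else 0

theorem vsub_row (C : List (Fin n → Bool)) (d d' t t') :
    vsub (row C d t) (row C d' t') = row C (d - d') (t - t') := by
  have h (f g : Fin n → ℤ) : List.zipWith (· - ·) (List.ofFn f) (List.ofFn g)
      = List.ofFn (f - g) := List.ext_getElem (by simp) (by simp)
  simp only [vsub, row, List.map_ofFn]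
  rw [List.zipWith_append (by simp), List.zipWith_append (by simp), h, h, List.zipWith_map]
  congr 2
  · simp [List.zipWith_self]
  · congr 1
    funext v
    simp
    ring

/-- This is why `t` is stored with both signs: a single nonnegativity test checks the multiplicities
and also forces `t` to vanish. -/
theorem row_nonneg_iff {C : List (Fin n → Bool)} {d t} :
    (∀ x ∈ row C d t, 0 ≤ x) ↔ (∀ c ∈ C, 0 ≤ d c) ∧ t = 0 := by
  simp only [row, List.mem_append, List.mem_map, List.mem_ofFn]
  constructor
  · intro h
    refine ⟨fun c hc => h _ (.inl ⟨c, hc, rfl⟩), funext fun v => ?_⟩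
    have h1 := h (t v) (.inr (.inr ⟨v, rfl⟩))
    have h2 := h (-t v) (.inr (.inl ⟨_, ⟨v, rfl⟩, rfl⟩))
    simp only [Pi.zero_apply]
    omega
  · rintro ⟨h, rfl⟩ x (⟨c, hc, rfl⟩ | ⟨_, ⟨v, rfl⟩, rfl⟩ | ⟨v, rfl⟩)
    · exact h c hc
    · simp
    · simp

def tRow (k n : ℕ) : ℕ := (k + 1) * (tEq n + tVec n + 60)

theorem row_run (c : Fin n → Bool) (t : Fin n → ℤ) : ∀ (C : List (Fin n → Bool)),
    FunLe prog 15 (.cons (.cons (vec (bits c)) (vec (List.ofFn t))) (mat (C.map bits)))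
      (vec (row C (negUnit c) t)) (tRow C.length n)
  | [] => (FunLe.rec_nil rfl (.split (.var rfl) (.call (negAppend_run _ _)
      (.cons (.var rfl) (.var rfl))))).of (by simp [row]) (by simp [tRow]; omega)
  | c' :: C =>
    (FunLe.rec_cons rfl (.var rfl) (row_run c t C) (.split (.var rfl) (.cons
      (.test (.call (eq_run (bits c') (bits c) (by simp)) (.cons (.var rfl) (.var rfl))) .lit .lit)
      (.var rfl)))).of
      (by
        simp only [row, List.map_cons, vec, List.cons_append, Val.ofList, negUnit,
          bits_injective.eq_iff, eq_comm (a := c)]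
        split_ifs <;> rfl)
      (by simp only [tRow]; rw [List.length_cons, Nat.succ_mul (C.length + 1), length_bits]; omega)

def rows (C L : List (Fin n → Bool)) : List (List ℤ) :=
  L.map fun c => row C (negUnit c) (bitFun c)

def tRows (k n : ℕ) : ℕ := (k + 2) * (tRow k n + 40)

theorem rows_run (C : List (Fin n → Bool)) : ∀ (L : List (Fin n → Bool)),
    FunLe prog 16 (.cons (mat (C.map bits)) (mat (L.map bits))) (mat (rows C L))
      ((L.length + 1) * (tRow C.length n + 40))
  | [] => (FunLe.rec_nil rfl .nil).of rfl (by simp)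
  | c :: L =>
    (FunLe.rec_cons rfl (.var rfl) (rows_run C L) (.cons (.call (row_run c (bitFun c) C)
      (.cons (.cons (.var rfl) (.var rfl)) (.var rfl))) (.var rfl))).of rfl
      (by rw [List.length_cons, Nat.succ_mul (L.length + 1)]; omega)

theorem subAll_run {m : ℕ} (a : List ℤ) (L : List (List ℤ)) (ha : a.length = m) :
    ∀ (B : List (List ℤ)), (∀ b ∈ B, b.length = m) →
    FunLe prog 17 (.cons (.cons (vec a) (mat L)) (mat B)) (mat (B.map (vsub a) ++ L))
      ((B.length + 1) * (tVec m + 40))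
  | [], _ => (FunLe.rec_nil rfl (.split (.var rfl) (.var rfl))).of rfl (by simp)
  | b :: B, h =>
    (FunLe.rec_cons rfl (.var rfl) (subAll_run a L ha B fun b' hb' => h b' (by simp [hb']))
      (.split (.var rfl) (.cons (.call (sub_run a b (by rw [ha, h b (by simp)]))
        (.cons (.var rfl) (.var rfl))) (.var rfl)))).of rfl
      (by rw [List.length_cons, Nat.succ_mul (B.length + 1), ha]; omega)

def diffs (A B : List (List ℤ)) : List (List ℤ) := A.flatMap fun a => B.map (vsub a)

theorem length_diffs (A B : List (List ℤ)) : (diffs A B).length = A.length * B.length := by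
  simp [diffs, List.length_flatMap]

theorem mem_diffs {A B : List (List ℤ)} {x : List ℤ} :
    x ∈ diffs A B ↔ ∃ a ∈ A, ∃ b ∈ B, vsub a b = x := by
  simp [diffs]

theorem diffs_run {m : ℕ} (B : List (List ℤ)) (hB : ∀ b ∈ B, b.length = m) :
    ∀ (A : List (List ℤ)), (∀ a ∈ A, a.length = m) →
    FunLe prog 18 (.cons (mat B) (mat A)) (mat (diffs A B))
      ((A.length + 1) * ((B.length + 1) * (tVec m + 40) + 40))
  | [], _ => (FunLe.rec_nil rfl .nil).of rfl (by simp)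
  | a :: A, h =>
    (FunLe.rec_cons rfl (.var rfl) (diffs_run B hB A fun a' ha' => h a' (by simp [ha']))
      (.call (subAll_run a (diffs A B) (h a (by simp)) B hB)
        (.cons (.cons (.var rfl) (.var rfl)) (.var rfl)))).of rfl
      (by rw [List.length_cons, Nat.succ_mul (A.length + 1)]; omega)

/-! ### Search -/

/-- The lists of the vectors to explore and of the vectors found, after the exploration of the
moves from `s`. -/
def expand (s : List ℤ) (p : List (List ℤ) × List (List ℤ)) :
    List (List ℤ) → List (List ℤ) × List (List ℤ)
  | [] => p
  | m :: M => if ∀ x ∈ vsub s m, 0 ≤ x then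
      if vsub s m ∈ (expand s p M).2 then expand s p M
      else (vsub s m :: (expand s p M).1, vsub s m :: (expand s p M).2)
    else expand s p M

/-- The same list `l` of new vectors is put in front of both lists. Hence the vectors that are seen
and no longer to be explored remain the same, except for `s`. -/
theorem expand_spec (s : List ℤ) (p) (hp : p.2.Nodup) : ∀ M, ∃ l : List (List ℤ),
    expand s p M = (l ++ p.1, l ++ p.2) ∧ (l ++ p.2).Nodup ∧
    (∀ x ∈ l, ∃ m ∈ M, vsub s m = x ∧ ∀ y ∈ x, 0 ≤ y) ∧
    ∀ m ∈ M, (∀ y ∈ vsub s m, 0 ≤ y) → vsub s m ∈ l ++ p.2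
  | [] => ⟨[], by simp [expand, hp]⟩
  | m :: M => by
    obtain ⟨l, h1, h2, h3, h4⟩ := expand_spec s p hp M
    unfold expand
    rw [h1]
    have h3' : ∀ x ∈ l, ∃ m' ∈ m :: M, vsub s m' = x ∧ ∀ y ∈ x, 0 ≤ y := fun x hx => by
      obtain ⟨m', hm', h⟩ := h3 x hx
      exact ⟨m', by simp [hm'], h⟩
    split_ifs with h h'
    · refine ⟨l, rfl, h2, h3', ?_⟩
      rintro m' (_ | ⟨_, hm'⟩) hn
      exacts [h', h4 m' hm' hn]
    · refine ⟨vsub s m :: l, rfl, List.nodup_cons.2 ⟨h', h2⟩, ?_, ?_⟩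
      · rintro x (_ | ⟨_, hx⟩)
        exacts [⟨m, by simp, rfl, h⟩, h3' x hx]
      · rintro m' (_ | ⟨_, hm'⟩) hn
        · simp
        · exact List.mem_cons_of_mem _ (h4 m' hm' hn)
    · refine ⟨l, rfl, h2, h3', ?_⟩
      rintro m' (_ | ⟨_, hm'⟩) hn
      exacts [absurd hn h, h4 m' hm' hn]

def tExpand (c N m : ℕ) : ℕ := (c + 1) * (2 * tVec m + tMem N m + 80)

theorem expand_run {N k : ℕ} (s : List ℤ) (p) (hs : s.length = k)
    (hp : ∀ x ∈ p.2, x.length = k) : ∀ M : List (List ℤ), (∀ m ∈ M, m.length = k) →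
    (expand s p M).2.length ≤ N →
    (∀ x ∈ (expand s p M).2, x.length = k) ∧
    FunLe prog 19 (.cons (.cons (vec s) (.cons (mat p.1) (mat p.2))) (mat M))
      (.cons (mat (expand s p M).1) (mat (expand s p M).2)) (tExpand M.length N k)
  | [], _, _ => ⟨hp, (FunLe.rec_nil rfl (.split (.var rfl) (.var rfl))).of rfl (by simp [tExpand])⟩
  | m :: M, hM, hN => by
    have hN' : (expand s p M).2.length ≤ N := by
      refine le_trans ?_ hN
      simp only [expand]; split_ifs <;> simp
    have hm : m.length = k := hM m (by simp)
    have hl : (vsub s m).length = k := by rw [length_vsub (by rw [hs, hm]), hs]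
    obtain ⟨h1, h2⟩ := expand_run s p hs hp M (fun m' hm' => hM m' (by simp [hm'])) hN'
    refine ⟨?_, (FunLe.rec_cons rfl (.var rfl) h2 (.split (.var rfl) (.bind
      (.call (sub_run s m (by rw [hs, hm])) (.cons (.var rfl) (.var rfl)))
      (.test (.call (nonneg_run (vsub s m)) (.cons .nil (.var rfl)))
        (.split (.var rfl) (.test (.call (mem_run (vsub s m) (expand s p M).2
          (by rw [hl]; exact h1)) (.cons (.var rfl) (.var rfl)))
          (.var rfl) (.cons (.cons (.var rfl) (.var rfl)) (.cons (.var rfl) (.var rfl)))))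
        (.var rfl))))).of ?_ ?_⟩
    · intro x
      simp only [expand]
      split_ifs
      · exact h1 x
      · rintro (_ | ⟨_, hx⟩)
        exacts [hl, h1 x hx]
      · exact h1 x
    · simp only [expand]; split_ifs <;> rfl
    · have := tMem_mono hN' (le_refl k)
      simp only [tExpand]
      rw [List.length_cons, Nat.succ_mul (M.length + 1), hs, hl]
      omega

/-- The search finds a set of vectors in `V` that is closed under the moves. -/
theorem search_run {N k : ℕ} (M : List (List ℤ)) (hM : ∀ m ∈ M, m.length = k)
    (V : List ℤ → Prop) (hV : ∀ x, V x → x.length = k)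
    (hN : ∀ l : List (List ℤ), l.Nodup → (∀ x ∈ l, V x) → l.length ≤ N)
    (hVM : ∀ x, V x → ∀ m ∈ M, (∀ y ∈ vsub x m, 0 ≤ y) → V (vsub x m)) (r : ℕ) :
    ∀ todo seen : List (List ℤ), seen.Nodup → (∀ x ∈ seen, V x) → (∀ x ∈ todo, x ∈ seen) →
    (∀ x ∈ seen, x ∉ todo → ∀ m ∈ M, (∀ y ∈ vsub x m, 0 ≤ y) → vsub x m ∈ seen) →
    N - seen.length + todo.length = r →
    ∃ out : List (List ℤ), FunLe prog 20 (.cons (mat M) (.cons (mat todo) (mat seen))) (mat out)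
        ((r + 1) * (tExpand M.length N k + 60)) ∧
      out.Nodup ∧ (∀ x ∈ out, V x) ∧ (∀ x ∈ seen, x ∈ out) ∧
      ∀ x ∈ out, ∀ m ∈ M, (∀ y ∈ vsub x m, 0 ≤ y) → vsub x m ∈ out := by
  induction r with
  | zero =>
    intro todo seen h1 h2 h3 h4 h5
    obtain rfl : todo = [] := List.length_eq_zero_iff.1 (by omega)
    exact ⟨seen, ⟨_, rfl, (EvalLe.split (.var rfl) (.split (.var rfl) (.split_nil (.var rfl)
      (.var rfl)))).of rfl (by omega)⟩, h1, h2, fun _ h => h, fun x hx => h4 x hx (by simp)⟩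
  | succ r ih =>
    rintro (_ | ⟨s, todo⟩) seen h1 h2 h3 h4 h5
    · exact ⟨seen, ⟨_, rfl, (EvalLe.split (.var rfl) (.split (.var rfl) (.split_nil (.var rfl)
        (.var rfl)))).of rfl (by rw [Nat.succ_mul]; omega)⟩, h1, h2, fun _ h => h,
        fun x hx => h4 x hx (by simp)⟩
    · have hs : V s := h2 s (h3 s (by simp))
      obtain ⟨l, e1, e2, e3, e4⟩ := expand_spec s (todo, seen) h1 M
      have hV' : ∀ x ∈ l ++ seen, V x := by
        intro x hx
        rcases List.mem_append.1 hx with hx | hx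
        · obtain ⟨m, hm, rfl, hy⟩ := e3 x hx
          exact hVM s hs m hm hy
        · exact h2 x hx
      -- The enlarged list still has at most `N` entries, so the truncated subtraction in the
      -- measure is exact: the new vectors cancel, and the measure drops by one because `s` has left
      -- the list of vectors to explore.
      have hlen := hN _ e2 hV'
      have he := (expand_run (N := N) s (todo, seen) (hV s hs) (fun x hx => hV x (h2 x hx)) M hM
        (by rw [e1]; exact hlen)).2
      simp only [List.length_append] at hlen
      obtain ⟨out, o1, o2, o3, o4, o5⟩ := ih (l ++ todo) (l ++ seen) e2 hV'
        (fun x hx => by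
          rcases List.mem_append.1 hx with hx | hx
          · simp [hx]
          · exact List.mem_append_right _ (h3 x (by simp [hx])))
        (fun x hx hx' m hm hy => by
          by_cases hxs : x = s
          · subst hxs; exact e4 m hm hy
          · rcases List.mem_append.1 hx with hx | hx
            · exact absurd (List.mem_append_left _ hx) hx'
            · exact List.mem_append_right _ (h4 x hx (fun h => hx' (List.mem_append_right _
                ((List.mem_cons.1 h).resolve_left hxs))) m hm hy))
        (by simp only [List.length_append, List.length_cons] at h5 ⊢; omega)
      rw [e1] at he
      refine ⟨out, ⟨_, rfl, (EvalLe.split (.var rfl) (.split (.var rfl) (.split (.var rfl)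
        (.call o1 (.cons (.var rfl) (.call he (.cons (.cons (.var rfl) (.cons (.var rfl) (.var rfl)))
          (.var rfl)))))))).of rfl (by rw [Nat.succ_mul (r + 1)]; omega)⟩, o2, o3,
          fun x hx => o4 x (List.mem_append_right _ hx), o5⟩

/-! ### Lists of indices -/

/-- The time is linear in the multiplicity itself, which is affordable because each copy is one
entry of the output. -/
theorem repeat_run (x : Val) (l : List Val) : ∀ (m : ℕ),
    FunLe prog 23 (.cons (.int m) (.cons x (.ofList l))) (.ofList (List.replicate m x ++ l))
      ((m + 1) * 30)
  | 0 => ⟨_, rfl, (EvalLe.split (.var rfl) (.split (.var rfl) (.ifLt_neg .lit (.var rfl)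
      (by simp) (.var rfl)))).of rfl (by omega)⟩
  | m + 1 => ⟨_, rfl, (EvalLe.split (.var rfl) (.split (.var rfl) (.ifLt_pos .lit (.var rfl)
      (by positivity) (.cons (.var rfl) (.call ((repeat_run x l m).of rfl le_rfl)
        (.cons (EvalLe.of (.sub (.var rfl) .lit) (by simp) le_rfl)
          (.cons (.var rfl) (.var rfl)))))))).of rfl
      (by omega)⟩

def indices : ℕ → List ℕ → List ℕ
  | _, [] => []
  | i, x :: a => List.replicate x i ++ indices (i + 1) a

def tIndices (M m : ℕ) : ℕ := (m + 1) * ((M + 1) * 30 + 40)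

theorem indices_run {M : ℕ} : ∀ (i : ℕ) (a : List ℕ), (∀ x ∈ a, x ≤ M) →
    FunLe prog 24 (.cons (.int i) (vec (a.map (↑)))) (vec ((indices i a).map (↑)))
      (tIndices M a.length)
  | _, [], _ => (FunLe.rec_nil rfl .nil).of rfl (by simp [tIndices])
  | i, x :: a, h =>
    (FunLe.rec_cons rfl (EvalLe.of (.sub (.var rfl) .lit) (w := .int (i + 1 : ℕ)) (by simp) le_rfl)
      (indices_run (i + 1) a fun y hy => h y (by simp [hy]))
      (.call (repeat_run (.int i) (((indices (i + 1) a).map (↑)).map .int) x)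
        (.cons (.var rfl) (.cons (.var rfl) (.var rfl))))).of
      (by simp [indices, vec])
      (by
        have : (x + 1) * 30 ≤ (M + 1) * 30 := by gcongr; exact h x (by simp)
        simp only [tIndices]
        rw [List.length_cons, Nat.succ_mul (a.length + 1)]
        omega)

theorem allIndices_run {M m : ℕ} : ∀ (A : List (List ℕ)), (∀ a ∈ A, a.length = m) →
    (∀ a ∈ A, ∀ x ∈ a, x ≤ M) →
    FunLe prog 25 (.cons .nil (mat (A.map (List.map (↑)))))
      (mat ((A.map (indices 0)).map (List.map (↑)))) ((A.length + 1) * (tIndices M m + 40))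
  | [], _, _ => (FunLe.rec_nil rfl .nil).of rfl (by simp)
  | a :: A, h, h' =>
    (FunLe.rec_cons rfl (.var rfl) (allIndices_run A (fun b hb => h b (by simp [hb]))
      fun b hb => h' b (by simp [hb]))
      (.cons (.call (indices_run 0 a (h' a (by simp))) (.cons .lit (.var rfl))) (.var rfl))).of rfl
      (by rw [h a (by simp), List.length_cons, Nat.succ_mul (A.length + 1)]; omega)

/-! ### Unions and intersections of sets of nodes -/

theorem sup_apply_iff {c c' : Fin n → Bool} {v : Fin n} : (c ⊔ c') v = true ↔ c v ∨ c' v := by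
  rw [Pi.sup_apply]
  cases c v <;> cases c' v <;> decide

theorem inf_apply_iff {c c' : Fin n → Bool} {v : Fin n} : (c ⊓ c') v = true ↔ c v ∧ c' v := by
  rw [Pi.inf_apply]
  cases c v <;> cases c' v <;> decide

/-! ### The standard components -/

/-- The labels `a` are nonnegative and do not decrease along the edges in `E`. -/
def Std (E : List (Fin n × Fin n)) (a : Fin n → ℤ) : Prop :=
  (∀ v, 0 ≤ a v) ∧ ∀ e ∈ E, a e.1 ≤ a e.2

theorem Std.add {E : List (Fin n × Fin n)} {a b : Fin n → ℤ} (ha : Std E a) (hb : Std E b) :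
    Std E (a + b) :=
  ⟨fun v => add_nonneg (ha.1 v) (hb.1 v), fun e he => add_le_add (ha.2 e he) (hb.2 e he)⟩

/-- `c` is the set of nodes with label `1` of a 0-1 graph `H` such that `H` and `g - H` are
standard. -/
def Good (E : List (Fin n × Fin n)) (g : Fin n → ℤ) (c : Fin n → Bool) : Prop :=
  Std E (bitFun c) ∧ Std E (g - bitFun c)

def Closed (E : List (Fin n × Fin n)) (g : Fin n → ℤ) (c : Fin n → Bool) : Prop :=
  ∀ e ∈ E, (c e.1 → c e.2) ∧ (¬ g e.1 < g e.2 → c e.2 → c e.1)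

/-- Along an edge where `c` does not decrease, subtracting `c` from the integer labels destroys
monotonicity only if the labels agree and just the head lies in `c`. Nonnegativity of the difference
says that `c` is contained in the support. -/
theorem good_iff {E : List (Fin n × Fin n)} {g : Fin n → ℤ} (hg : Std E g) {c : Fin n → Bool} :
    Good E g c ↔ Closed E g c ∧ ∀ v, (if c v then 1 else 0) ≤ g v := by
  have h0 : ∀ v, 0 ≤ bitFun c v := fun v => by unfold bitFun; split_ifs <;> simp
  simp only [Good, Std, h0, implies_true, true_and, Pi.sub_apply, sub_nonneg, Closed]
  have h (e) (he : e ∈ E) : (bitFun c e.1 ≤ bitFun c e.2 ∧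
      g e.1 - bitFun c e.1 ≤ g e.2 - bitFun c e.2) ↔
      (c e.1 → c e.2) ∧ (¬ g e.1 < g e.2 → c e.2 → c e.1) := by
    have := hg.2 e he
    unfold bitFun
    by_cases h1 : c e.1 = true <;> by_cases h2 : c e.2 = true <;> simp [h1, h2] <;> omega
  constructor
  · rintro ⟨h1, h2, h3⟩
    exact ⟨fun e he => (h e he).1 ⟨h1 e he, h3 e he⟩, h2⟩
  · rintro ⟨h1, h2⟩
    exact ⟨fun e he => ((h e he).2 (h1 e he)).1, h2, fun e he => ((h e he).2 (h1 e he)).2⟩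

/-- By `good_iff` the conditions are implications from one node to another and bounds at single
nodes. Such conditions pass to unions, and equally to intersections in `good_inf`. -/
theorem good_sup {E : List (Fin n × Fin n)} {g : Fin n → ℤ} (hg : Std E g) {c c' : Fin n → Bool}
    (h : Good E g c) (h' : Good E g c') : Good E g (c ⊔ c') := by
  rw [good_iff hg] at *
  refine ⟨fun e he => ?_, fun v => ?_⟩
  · have := h.1 e he
    have := h'.1 e he
    simp only [sup_apply_iff]
    tauto
  · have := h.2 v
    have := h'.2 v
    by_cases h1 : c v = true <;> by_cases h2 : c' v = true <;> simp_all

theorem good_inf {E : List (Fin n × Fin n)} {g : Fin n → ℤ} (hg : Std E g) {c c' : Fin n → Bool}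
    (h : Good E g c) (h' : Good E g c') : Good E g (c ⊓ c') := by
  rw [good_iff hg] at *
  refine ⟨fun e he => ?_, fun v => ?_⟩
  · have := h.1 e he
    have := h'.1 e he
    simp only [inf_apply_iff]
    tauto
  · have := h.2 v
    have := h'.2 v
    by_cases h1 : c v = true <;> by_cases h2 : c' v = true <;> simp_all

/-- `U v` is the least set with the property `Q` that contains `v`. -/
structure IsLeast (Q : (Fin n → Bool) → Prop) (U : Fin n → Fin n → Bool) : Prop where
  self : ∀ v, U v v
  prop : ∀ v, Q (U v)
  least : ∀ c v, Q c → c v → U v ≤ c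

/-- If the least set of `v` contains `a`, then a set that contains `v` and respects the new edge
contains `b`, hence the least set of `b`; and the union of the two least sets already has the
required property. Otherwise the new edge imposes nothing. -/
theorem IsLeast.addEdge {Q : (Fin n → Bool) → Prop} {U : Fin n → Fin n → Bool}
    (h : IsLeast Q U) (hQ : ∀ c c', Q c → Q c' → Q (c ⊔ c')) (a b : Fin n) :
    IsLeast (fun c => Q c ∧ (c a → c b)) (addEdge U a b) where
  self v := by
    have := h.self v
    unfold Decomp.addEdge
    split_ifs <;> simp [this]
  prop v := by
    have := h.self b
    unfold Decomp.addEdge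
    split_ifs with h1
    · exact ⟨hQ _ _ (h.prop v) (h.prop b), by simp [this]⟩
    · exact ⟨h.prop v, fun h2 => absurd h2 h1⟩
  least c v hc hv := by
    unfold Decomp.addEdge
    split_ifs with h1
    · exact sup_le (h.least c v hc.1 hv) (h.least c b hc.1 (hc.2 (h.least c v hc.1 hv a h1)))
    · exact h.least c v hc.1 hv

theorem IsLeast.congr {Q Q' : (Fin n → Bool) → Prop} {U : Fin n → Fin n → Bool}
    (h : IsLeast Q U) (hQ : ∀ c, Q c ↔ Q' c) : IsLeast Q' U := by
  rwa [← funext fun c => propext (hQ c)]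

theorem closed_sup {E : List (Fin n × Fin n)} {g : Fin n → ℤ} {c c' : Fin n → Bool}
    (h : Closed E g c) (h' : Closed E g c') : Closed E g (c ⊔ c') := by
  intro e he
  have := h e he
  have := h' e he
  simp only [sup_apply_iff]
  tauto

theorem closures_isLeast (g : Fin n → ℤ) : ∀ (E : List (Fin n × Fin n)),
    IsLeast (Closed E g) (closures g E)
  | [] => ⟨by simp [closures], by simp [Closed], fun c v _ hv w hw => by
      simp only [closures, decide_eq_true_eq] at hw
      rwa [hw]⟩
  | e :: E => by
    have ih := (closures_isLeast g E).addEdge (fun _ _ => closed_sup) e.1 e.2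
    unfold closures
    split_ifs with h
    · exact ih.congr fun c => by simp only [Closed, List.forall_mem_cons]; tauto
    · refine (ih.addEdge (fun c c' h1 h2 => ⟨closed_sup h1.1 h2.1, ?_⟩) e.2 e.1).congr
        fun c => by simp only [Closed, List.forall_mem_cons]; tauto
      have := h1.2
      have := h2.2
      simp only [sup_apply_iff]
      tauto

theorem mem_extend {u x : Fin n → Bool} {L₀ : List (Fin n → Bool)} : ∀ {L : List (Fin n → Bool)},
    x ∈ extend u L₀ L ↔ x ∈ L₀ ∨ x = u ∨ ∃ s ∈ L, x = s ⊔ u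
  | [] => by
    unfold extend
    split_ifs with h
    · simp only [List.not_mem_nil, false_and, exists_false, or_false]
      exact ⟨.inl, fun h' => h'.elim id fun e => e ▸ h⟩
    · simp [or_comm]
  | s :: L => by
    have ih := mem_extend (u := u) (L₀ := L₀) (L := L) (x := x)
    unfold extend
    split_ifs with h
    · rw [ih]
      simp only [List.mem_cons, exists_eq_or_imp]
      refine ⟨by tauto, ?_⟩
      rintro (h' | h' | rfl | h')
      exacts [.inl h', .inr (.inl h'), mem_extend.1 h, .inr (.inr h')]
    · simp only [List.mem_cons, exists_eq_or_imp, ih]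
      tauto

theorem nodup_extend {u : Fin n → Bool} {L₀ : List (Fin n → Bool)} (h : L₀.Nodup) :
    ∀ {L : List (Fin n → Bool)}, (extend u L₀ L).Nodup
  | [] => by
    unfold extend
    split_ifs with h'
    exacts [h, List.nodup_cons.2 ⟨h', h⟩]
  | s :: L => by
    have ih := nodup_extend (u := u) h (L := L)
    unfold extend
    split_ifs with h'
    exacts [ih, List.nodup_cons.2 ⟨h', ih⟩]

theorem nodup_comps (g : Fin n → ℤ) : ∀ U, (comps g U).Nodup
  | [] => List.nodup_nil
  | u :: U => by
    have := nodup_comps g U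
    unfold comps
    split_ifs
    exacts [nodup_extend this, this]

theorem prop_comps {g : Fin n → ℤ} {Q : (Fin n → Bool) → Prop}
    (hQ : ∀ c c', Q c → Q c' → Q (c ⊔ c')) : ∀ {U : List (Fin n → Bool)},
    (∀ u ∈ U, (∀ v, (if u v then 1 else 0) ≤ g v) → Q u) → ∀ c ∈ comps g U, Q c
  | [], _ => by simp [comps]
  | u :: U, h => by
    have ih := prop_comps hQ (U := U) (g := g) fun u' hu' => h u' (by simp [hu'])
    unfold comps
    split_ifs with hu
    · intro c hc
      have := h u (by simp) hu
      rcases mem_extend.1 hc with hc | rfl | ⟨s, hs, rfl⟩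
      exacts [ih c hc, this, hQ _ _ (ih s hs) this]
    · exact ih

/-- Absorbing one generator at a time, as stated here, suffices to reach all finite nonempty unions
of generators. Stability under later generators is commutativity of unions, and stability at the
generator's own turn is idempotence. -/
theorem comps_complete {g : Fin n → ℤ} {u : Fin n → Bool}
    (hu : ∀ v, (if u v then 1 else 0) ≤ g v) : ∀ {U : List (Fin n → Bool)}, u ∈ U →
    u ∈ comps g U ∧ ∀ c ∈ comps g U, c ⊔ u ∈ comps g U
  | u' :: U, h => by
    unfold comps
    by_cases e : u = u'
    · subst e
      simp only [hu, implies_true, if_true, mem_extend, true_or, or_true, true_and]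
      rintro c (hc | rfl | ⟨s, hs, rfl⟩)
      · exact .inr (.inr ⟨c, hc, rfl⟩)
      · simp
      · exact .inr (.inr ⟨s, hs, by rw [sup_assoc, sup_idem]⟩)
    · obtain ⟨h1, h2⟩ := comps_complete hu ((List.mem_cons.1 h).resolve_left e)
      split_ifs with h'
      · refine ⟨mem_extend.2 (.inl h1), fun c hc => mem_extend.2 ?_⟩
        rcases mem_extend.1 hc with hc | rfl | ⟨s, hs, rfl⟩
        · exact .inl (h2 c hc)
        · exact .inr (.inr ⟨u, h1, sup_comm _ _⟩)
        · exact .inr (.inr ⟨s ⊔ u, h2 s hs, sup_right_comm _ _ _⟩)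
      · exact ⟨h1, h2⟩

theorem mem_comps_iff {E : List (Fin n × Fin n)} {g : Fin n → ℤ} (hg : Std E g)
    {c : Fin n → Bool} :
    c ∈ comps g (List.ofFn (closures g E)) ↔ Good E g c ∧ c ≠ ⊥ := by
  have hU := closures_isLeast g E
  constructor
  · refine prop_comps (Q := fun c => Good E g c ∧ c ≠ ⊥)
      (fun c c' h h' => ⟨good_sup hg h.1 h'.1, fun e => h.2 (sup_eq_bot_iff.1 e).1⟩) ?_ c
    intro u hu hu'
    obtain ⟨v, rfl⟩ := List.mem_ofFn.1 hu
    refine ⟨(good_iff hg).2 ⟨hU.prop v, hu'⟩, fun e => ?_⟩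
    have := hU.self v
    rw [e] at this
    simp at this
  · rintro ⟨hc, hne⟩
    rw [good_iff hg] at hc
    have hmem (v) (hv : c v) : closures g E v ∈ comps g (List.ofFn (closures g E)) ∧
        ∀ c' ∈ comps g (List.ofFn (closures g E)), c' ⊔ closures g E v ∈
          comps g (List.ofFn (closures g E)) := by
      refine comps_complete (fun w => ?_) (List.mem_ofFn.2 ⟨v, rfl⟩)
      have h1 := hc.2 w
      have h2 := hU.least c v hc.1 hv w
      have : closures g E v w = true → c w = true := h2
      split_ifs at * <;> simp_all
      omega
    -- The induction starts at singletons, because the empty union is not in the list.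
    have key : ∀ s : Finset (Fin n), s.Nonempty → (∀ v ∈ s, c v) →
        s.sup (closures g E) ∈ comps g (List.ofFn (closures g E)) := by
      intro s hs
      induction hs using Finset.Nonempty.cons_induction with
      | singleton v =>
        intro h
        rw [Finset.sup_singleton]
        exact (hmem v (h v (by simp))).1
      | cons v s hv hs ih =>
        intro h
        rw [Finset.sup_cons, sup_comm]
        exact (hmem v (h v (by simp))).2 _ (ih fun w hw => h w (by simp [hw]))
    -- A closed set is the union of the least closed sets of its nodes.
    have heq : (Finset.univ.filter fun v => c v = true).sup (closures g E) = c := by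
      apply le_antisymm
      · exact Finset.sup_le fun v hv => hU.least c v hc.1 (by simpa using hv)
      · intro v hv
        exact Finset.le_sup (f := closures g E) (s := Finset.univ.filter fun v => c v = true)
          (by simpa using hv) v (hU.self v)
    rw [← heq]
    refine key _ ?_ (by simp)
    obtain ⟨v, hv⟩ := Function.ne_iff.1 hne
    exact ⟨v, by simpa using hv⟩

/-! ### Exchanges -/

/-- The intersection of two sets, as a multiset with at most one element, which is nonempty. -/
def meet (c c' : Fin n → Bool) : Multiset (Fin n → Bool) := if c ⊓ c' = ⊥ then 0 else {c ⊓ c'}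

/-- `C` consists of nonempty sets, and is closed under unions and nonempty intersections. -/
structure IsRing (C : List (Fin n → Bool)) : Prop where
  bot : ⊥ ∉ C
  sup : ∀ c ∈ C, ∀ c' ∈ C, c ⊔ c' ∈ C
  inf : ∀ c ∈ C, ∀ c' ∈ C, c ⊓ c' ≠ ⊥ → c ⊓ c' ∈ C

def Exchange (C : List (Fin n → Bool)) (D D' : Multiset (Fin n → Bool)) : Prop :=
  ∃ c ∈ C, ∃ c' ∈ C, D = {c, c'} ∧ D' = (c ⊔ c') ::ₘ meet c c'

def total (D : Multiset (Fin n → Bool)) : Fin n → ℤ := (D.map bitFun).sum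

theorem total_cons (c : Fin n → Bool) (D) : total (c ::ₘ D) = bitFun c + total D := by
  simp [total]

theorem total_add (D D' : Multiset (Fin n → Bool)) : total (D + D') = total D + total D' := by
  simp [total]

@[simp] theorem bitFun_bot : bitFun (⊥ : Fin n → Bool) = 0 := by
  funext v; simp [bitFun]

theorem bitFun_sup_add_inf (c c' : Fin n → Bool) :
    bitFun (c ⊔ c') + bitFun (c ⊓ c') = bitFun c + bitFun c' := by
  funext v
  simp only [bitFun, Pi.add_apply, sup_apply_iff, inf_apply_iff]
  by_cases h : c v = true <;> by_cases h' : c' v = true <;> simp [h, h']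

theorem total_meet (c c' : Fin n → Bool) : total (meet c c') = bitFun (c ⊓ c') := by
  unfold meet
  split_ifs with h
  · simp [h, total]
  · simp [total]

theorem bitFun_nonneg (c : Fin n → Bool) : 0 ≤ bitFun c := fun v => by
  simp only [bitFun, Pi.zero_apply]; split_ifs <;> simp

theorem total_nonneg (D : Multiset (Fin n → Bool)) : 0 ≤ total D := by
  induction D using Multiset.induction with
  | empty => simp [total]
  | cons c D ih => rw [total_cons]; exact add_nonneg (bitFun_nonneg c) ih

/-- The support of a labeling. -/
def supp (a : Fin n → ℤ) : Fin n → Bool := fun v => decide (0 < a v)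

/-- The union is thus determined by the sum alone, so all decompositions of the same labeling lead
to the same first set of the chain. -/
theorem sup_eq_supp (D : Multiset (Fin n → Bool)) : D.sup = supp (total D) := by
  induction D using Multiset.induction with
  | empty => funext v; simp [total, supp]
  | cons c D ih =>
    funext v
    have := total_nonneg D v
    rw [Multiset.sup_cons, total_cons, ih, Bool.eq_iff_iff, sup_apply_iff]
    simp only [supp, bitFun, Pi.add_apply, decide_eq_true_eq, Pi.zero_apply] at *
    split_ifs with h <;> simp [h]
    omega

theorem eq_zero_of_total {D : Multiset (Fin n → Bool)} (hD : ⊥ ∉ D) (h : total D = 0) : D = 0 := by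
  refine Multiset.eq_zero_of_forall_notMem fun c hc => hD ?_
  have h1 : c ≤ D.sup := Multiset.le_sup hc
  have h2 : D.sup = ⊥ := by rw [sup_eq_supp, h]; funext v; simp [supp]
  rwa [← le_bot_iff.1 (h2 ▸ h1)]

/-- Induction on `D`: once the rest contains its own union, one exchange of `c` with that union
produces the union of all of `D`. The intersection is left over and joins the remainder. The
congruence generated by exchanges allows them inside larger multisets. -/
theorem exists_sup_cons {C : List (Fin n → Bool)} (hC : IsRing C) (D : Multiset (Fin n → Bool))
    (hD : ∀ c ∈ D, c ∈ C) (h0 : D ≠ 0) : D.sup ∈ C ∧ ∃ D' : Multiset (Fin n → Bool),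
      (∀ c ∈ D', c ∈ C) ∧ addConGen (Exchange C) D (D.sup ::ₘ D') ∧
      total D = total (D.sup ::ₘ D') := by
  induction D using Multiset.induction with
  | empty => exact absurd rfl h0
  | cons c D ih =>
    have hc : c ∈ C := hD c (by simp)
    by_cases hD0 : D = 0
    · subst hD0
      exact ⟨by simpa using hc, 0, by simp, by simpa using AddCon.refl _ _, by simp⟩
    · obtain ⟨h1, D', h2, h3, h4⟩ := ih (fun c' h => hD c' (by simp [h])) hD0
      rw [Multiset.sup_cons]
      refine ⟨hC.sup c hc _ h1, meet c D.sup + D', ?_, ?_, ?_⟩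
      · intro c' hc'
        rcases Multiset.mem_add.1 hc' with h | h
        · unfold meet at h
          split_ifs at h with h'
          · simp at h
          · rw [Multiset.mem_singleton.1 h]
            exact hC.inf c hc _ h1 h'
        · exact h2 c' h
      · have e1 : addConGen (Exchange C) ({c} + D) ({c} + D.sup ::ₘ D') :=
          AddCon.add _ (AddCon.refl _ _) h3
        have e2 : addConGen (Exchange C) ({c, D.sup} + D')
            (((c ⊔ D.sup) ::ₘ meet c D.sup) + D') :=
          AddCon.add _ (AddConGen.Rel.of _ _ ⟨c, hc, _, h1, rfl, rfl⟩) (AddCon.refl _ _)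
        have e3 : ({c} + D.sup ::ₘ D' : Multiset (Fin n → Bool)) = {c, D.sup} + D' := by
          simp [Multiset.insert_eq_cons, Multiset.cons_swap]
        rw [Multiset.singleton_add, e3] at e1
        rw [Multiset.cons_add] at e2
        exact AddCon.trans _ e1 e2
      · rw [total_cons, h4, total_cons, total_cons, total_add, total_meet, ← add_assoc,
          ← bitFun_sup_add_inf, add_assoc]

/-- `D` is the decomposition of `a` into a chain of sets. -/
inductive IsChainOf : (Fin n → ℤ) → Multiset (Fin n → Bool) → Prop
  | zero : IsChainOf 0 0
  | cons {a D} : a ≠ 0 → IsChainOf (a - bitFun (supp a)) D → IsChainOf a (supp a ::ₘ D)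

theorem IsChainOf.total {a : Fin n → ℤ} {D} (h : IsChainOf a D) : total D = a := by
  induction h with
  | zero => simp [Decomp.total]
  | cons _ _ ih => rw [total_cons, ih]; abel

/-- Any `D` with sum `a` can be given the member `supp a`. What remains has sum `a - bitFun (supp
a)`, and the induction goes on there. -/
theorem IsChainOf.addConGen {C : List (Fin n → Bool)} (hC : IsRing C) {a : Fin n → ℤ}
    {D₀ : Multiset (Fin n → Bool)} (h : IsChainOf a D₀) : ∀ D : Multiset (Fin n → Bool),
    (∀ c ∈ D, c ∈ C) → Decomp.total D = a → addConGen (Exchange C) D D₀ := by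
  induction h with
  | zero =>
    intro D hD h
    rw [eq_zero_of_total (fun hb => hC.bot (hD _ hb)) h]
    exact AddCon.refl _ _
  | @cons a D₀ ha _ ih =>
    intro D hD h
    have h0 : D ≠ 0 := by
      rintro rfl
      exact ha (h ▸ by simp [Decomp.total])
    obtain ⟨-, D', h2, h3, h4⟩ := exists_sup_cons hC D hD h0
    have hs : D.sup = supp a := by rw [sup_eq_supp, h]
    rw [hs] at h3 h4
    have := ih D' h2 (eq_sub_of_add_eq' (by rw [← total_cons, ← h4, h]))
    refine AddCon.trans _ h3 ?_
    rw [← Multiset.singleton_add, ← Multiset.singleton_add]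
    exact AddCon.add _ (AddCon.refl _ _) this

/-- Lowering all positive labels by one is a monotone operation, so `a - bitFun (supp a)` stays
standard. Adding it to the standard `g - a` gives `g - bitFun (supp a)`. -/
theorem std_supp {E : List (Fin n × Fin n)} {g a : Fin n → ℤ} (ha : Std E a)
    (hg : Std E (g - a)) : Good E g (supp a) ∧ Std E (a - bitFun (supp a)) := by
  have h1 : Std E (bitFun (supp a)) := by
    refine ⟨bitFun_nonneg _, fun e he => ?_⟩
    have := ha.2 e he
    simp only [bitFun, supp, decide_eq_true_eq]
    split_ifs <;> omega
  have h2 : Std E (a - bitFun (supp a)) := by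
    refine ⟨fun v => ?_, fun e he => ?_⟩
    · have := ha.1 v
      simp only [bitFun, supp, decide_eq_true_eq, Pi.sub_apply]
      split_ifs <;> omega
    · have := ha.2 e he
      have := ha.1 e.1
      simp only [bitFun, supp, decide_eq_true_eq, Pi.sub_apply]
      split_ifs <;> omega
  refine ⟨⟨h1, ?_⟩, h2⟩
  have := hg.add h2
  rwa [sub_add_sub_cancel] at this

theorem supp_ne_bot {a : Fin n → ℤ} (ha : 0 ≤ a) (h0 : a ≠ 0) : supp a ≠ ⊥ := by
  intro h
  refine h0 (funext fun v => ?_)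
  have h1 := congrFun h v
  have h2 := ha v
  simp only [supp, Pi.bot_apply, Pi.zero_apply] at *
  exact le_antisymm (not_lt.1 (of_decide_eq_false h1)) h2

theorem IsChainOf.mem {E : List (Fin n × Fin n)} {g a : Fin n → ℤ} {C : List (Fin n → Bool)}
    (hC : ∀ c, c ∈ C ↔ Good E g c ∧ c ≠ ⊥) {D : Multiset (Fin n → Bool)} (h : IsChainOf a D)
    (ha : Std E a) (hg : Std E (g - a)) : ∀ c ∈ D, c ∈ C := by
  induction h with
  | zero => simp
  | @cons a D h0 _ ih =>
    have hs := std_supp ha hg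
    intro c hc
    rcases Multiset.mem_cons.1 hc with rfl | hc
    · exact (hC _).2 ⟨hs.1, supp_ne_bot ha.1 h0⟩
    · refine ih hs.2 ?_ c hc
      rw [show g - (a - bitFun (supp a)) = (g - a) + bitFun (supp a) by abel]
      exact hg.add hs.1.1

/-! ### Computing the chain decomposition -/

def tChain (k n : ℕ) : ℕ := tVec (k + 2 * n) + 4 * tVec n + 2 * tRow k n + 100

theorem nonneg_neg_iff (a : Fin n → ℤ) :
    (∀ x ∈ (List.ofFn a).map (- ·) ++ [], 0 ≤ x) ↔ ∀ v, a v ≤ 0 := by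
  simp [List.mem_ofFn]

theorem vsub_ofFn (f g : Fin n → ℤ) : vsub (List.ofFn f) (List.ofFn g) = List.ofFn (f - g) :=
  List.ext_getElem (by simp [vsub]) (by simp [vsub])

theorem support_eq (a : Fin n → ℤ) :
    (List.ofFn a).map (fun x => if 0 < x then 1 else 0) = bits (supp a) := by
  simp only [bits, List.map_ofFn, supp, decide_eq_true_eq]
  rfl

theorem row_congr {C : List (Fin n → Bool)} {d d' : (Fin n → Bool) → ℤ} {t t' : Fin n → ℤ}
    (h : ∀ c ∈ C, d c = d' c) (ht : t = t') : row C d t = row C d' t' := by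
  subst ht
  simp only [row, List.map_congr_left h]

/-- The number `m` bounds the labels, each round lowers the positive ones by one, and the last part
of the row records how much of `g` is not yet accounted for. For `a = g` it vanishes, and the row is
a state of the search. -/
theorem chain_run {C : List (Fin n → Bool)} (hC : ⊥ ∉ C) (g : Fin n → ℤ) :
    ∀ (m : ℕ) (a : Fin n → ℤ), 0 ≤ a → (∀ v, a v ≤ m) → ∃ D, IsChainOf a D ∧
    FunLe prog 22 (.cons (.cons (mat (C.map bits)) (vec (List.ofFn g))) (vec (List.ofFn a)))
      (vec (row C (fun c => D.count c) (g - a))) ((m + 1) * tChain C.length n) := by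
  intro m
  induction m with
  | zero =>
    intro a h0 hm
    obtain rfl : a = 0 := funext fun v => le_antisymm (hm v) (h0 v)
    have h := (nonneg_run ((List.ofFn (0 : Fin n → ℤ)).map (- ·) ++ [])).of (w := .int 1)
      (B := tVec n) (by rw [if_pos ((nonneg_neg_iff (0 : Fin n → ℤ)).2 fun _ => le_refl _)]) (le_of_eq (by simp))
    -- At the end of the recursion the zero vector `a` itself is passed as a set. It represents `⊥`,
    -- which is not in `C`, so all multiplicities start at 0.
    have hb : bits (⊥ : Fin n → Bool) = List.ofFn (0 : Fin n → ℤ) := by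
      simp only [bits]
      congr 1
    refine ⟨0, .zero, _, rfl, (EvalLe.split (.var rfl) (.split (.var rfl) (.ifLt_pos .lit
      (.call h (.cons .nil (.call (negAppend_run [] _) (.cons .nil (.var rfl))))) one_pos
      (.call (row_run ⊥ g C) (.cons (.cons (EvalLe.of (.var rfl) (by rw [hb]) le_rfl)
        (.var rfl)) (.var rfl)))))).of ?_ ?_⟩
    · rw [row_congr (fun c hc => ?_) (sub_zero g).symm]
      have : ⊥ ≠ c := fun e => hC (e ▸ hc)
      simp [negUnit, this]
    · simp only [tChain, List.length_ofFn]; omega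
  | succ m ih =>
    intro a h0 hm
    by_cases ha : a = 0
    · subst ha
      obtain ⟨D, h1, h2⟩ := ih 0 le_rfl fun _ => by simp
      exact ⟨D, h1, h2.of rfl (by rw [Nat.succ_mul (m + 1)]; omega)⟩
    · have hle : ∀ v, 0 ≤ (a - bitFun (supp a)) v ∧ (a - bitFun (supp a)) v ≤ m := by
        intro v
        have h1 := h0 v
        have h2 := hm v
        simp only [Pi.sub_apply, bitFun, supp, decide_eq_true_eq, Pi.zero_apply] at *
        push_cast at h2
        split_ifs <;> omega
      obtain ⟨D, h1, h2⟩ := ih (a - bitFun (supp a)) (fun v => (hle v).1) fun v => (hle v).2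
      have hneg : ¬ ∀ v, a v ≤ 0 := fun h => ha (funext fun v => le_antisymm (h v) (h0 v))
      have h := (nonneg_run ((List.ofFn a).map (- ·) ++ [])).of (w := .int 0) (B := tVec n)
        (by rw [if_neg (mt (nonneg_neg_iff _).1 hneg)]) (le_of_eq (by simp))
      have hs := (support_run (List.ofFn a)).of (B := tVec n) (by rw [support_eq]) (le_of_eq (by simp))
      have hsub := (sub_run (List.ofFn a) (bits (supp a)) (by simp)).of (B := tVec n)
        (by rw [bits, show (fun v => if supp a v = true then (1 : ℤ) else 0) = bitFun (supp a)
          from rfl, vsub_ofFn]) (le_of_eq (by simp))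
      have hrow := (row_run (supp a) (bitFun (supp a)) C)
      -- Subtracting the negative unit row raises the multiplicity of `supp a` by one and changes
      -- the missing part to `g - a`.
      have hfin := sub_run (row C (fun c => D.count c) (g - (a - bitFun (supp a))))
        (row C (negUnit (supp a)) (bitFun (supp a))) (by simp)
      refine ⟨_, .cons ha h1, _, rfl, (EvalLe.split (.var rfl) (.split (.var rfl) (.ifLt_neg .lit
        (.call h (.cons .nil (.call (negAppend_run [] _) (.cons .nil (.var rfl)))))
        (lt_irrefl 0) (.bind (.call hs (.cons .nil (.var rfl))) (.call hfin (.cons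
          (.call hrow (.cons (.cons (.var rfl) (.var rfl)) (.var rfl)))
          (.call h2 (.cons (.var rfl) (.call hsub (.cons (.var rfl) (.var rfl))))))))))).of ?_ ?_⟩
      · rw [vsub_row]
        congr 1
        refine row_congr (fun c _ => ?_) (by abel)
        simp only [Pi.sub_apply, negUnit, Multiset.count_cons, eq_comm (a := c)]
        split_ifs <;> simp
      · rw [Nat.succ_mul (m + 1)]
        simp only [tChain, List.length_ofFn, length_row]
        omega

/-! ### States of the search -/

/-- `D` is a multiset of sets in `C` with sum `g`. -/
def IsDec (C : List (Fin n → Bool)) (g : Fin n → ℤ) (D : Multiset (Fin n → Bool)) : Prop :=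
  (∀ c ∈ D, c ∈ C) ∧ total D = g

/-- The vector that represents the multiset `D` in the search. -/
def state (C : List (Fin n → Bool)) (D : Multiset (Fin n → Bool)) : List ℤ :=
  row C (fun c => D.count c) 0

theorem state_injOn {C : List (Fin n → Bool)} {D D' : Multiset (Fin n → Bool)}
    (hD : ∀ c ∈ D, c ∈ C) (hD' : ∀ c ∈ D', c ∈ C) (h : state C D = state C D') : D = D' := by
  have h := (List.append_inj h (by simp)).1
  rw [List.map_inj_left] at h
  ext c
  by_cases hc : c ∈ C
  · exact_mod_cast h c hc
  · rw [Multiset.count_eq_zero_of_notMem (mt (hD c) hc),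
      Multiset.count_eq_zero_of_notMem (mt (hD' c) hc)]

/-- The sum of the sets in `C` with the multiplicities `d`. -/
def weight (C : List (Fin n → Bool)) (d : (Fin n → Bool) → ℤ) : Fin n → ℤ :=
  ∑ c ∈ C.toFinset, d c • bitFun c

theorem weight_sub (C : List (Fin n → Bool)) (d d') :
    weight C (d - d') = weight C d - weight C d' := by
  simp [weight, sub_smul, Finset.sum_sub_distrib]

theorem weight_negUnit {C : List (Fin n → Bool)} {c : Fin n → Bool} (hc : c ∈ ⊥ :: C) :
    weight C (negUnit c) = - bitFun c := by
  simp only [weight, negUnit, ite_smul, neg_smul, one_smul, zero_smul, Finset.sum_ite_eq,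
    List.mem_toFinset]
  rcases List.mem_cons.1 hc with rfl | hc
  · simp
  · simp [hc]

theorem weight_count {C : List (Fin n → Bool)} {D : Multiset (Fin n → Bool)}
    (hD : ∀ c ∈ D, c ∈ C) : weight C (fun c => D.count c) = total D := by
  rw [total, Finset.sum_multiset_map_count, weight]
  symm
  refine (Finset.sum_subset (fun c hc => ?_) fun c _ hc => ?_).trans
    (Finset.sum_congr rfl fun c _ => (natCast_zsmul _ _).symm)
  · exact List.mem_toFinset.2 (hD c (Multiset.mem_toFinset.1 hc))
  · rw [Multiset.count_eq_zero_of_notMem (mt Multiset.mem_toFinset.2 hc), zero_smul]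

theorem exists_isDec {C : List (Fin n → Bool)} {d : (Fin n → Bool) → ℤ} (hd : ∀ c ∈ C, 0 ≤ d c) :
    ∃ D, IsDec C (weight C d) D ∧ ∀ c ∈ C, (D.count c : ℤ) = d c := by
  let D : Multiset (Fin n → Bool) := ∑ c ∈ C.toFinset, (d c).toNat • {c}
  have h1 : ∀ c ∈ D, c ∈ C := by
    intro c hc
    obtain ⟨c', hc', h⟩ := Multiset.mem_sum.1 hc
    rw [Multiset.mem_singleton.1 (Multiset.mem_of_mem_nsmul h)]
    exact List.mem_toFinset.1 hc'
  have h2 : ∀ c ∈ C, (D.count c : ℤ) = d c := by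
    intro c hc
    have : D.count c = (d c).toNat := by
      simp [D, Multiset.count_sum', Multiset.count_singleton, hc]
    rw [this, Int.toNat_of_nonneg (hd c hc)]
  refine ⟨D, ⟨h1, ?_⟩, h2⟩
  rw [← weight_count h1]
  exact Finset.sum_congr rfl fun c hc =>
    congrArg (· • bitFun c) (h2 c (List.mem_toFinset.1 hc))

def moves (C : List (Fin n → Bool)) : List (List ℤ) :=
  diffs (diffs (rows C (⊥ :: C)) (rows C (⊥ :: C))) (diffs (rows C (⊥ :: C)) (rows C (⊥ :: C)))

theorem length_moves (C : List (Fin n → Bool)) : (moves C).length = (C.length + 1) ^ 4 := by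
  simp only [moves, length_diffs, rows, List.length_map, List.length_cons]
  ring

/-- The sets `c₁` and `c₄` are added, and `c₂` and `c₃` are removed. -/
def move (C : List (Fin n → Bool)) (c₁ c₂ c₃ c₄ : Fin n → Bool) : List ℤ :=
  row C (negUnit c₁ - negUnit c₂ - (negUnit c₃ - negUnit c₄))
    (bitFun c₁ - bitFun c₂ - (bitFun c₃ - bitFun c₄))

theorem mem_moves {C : List (Fin n → Bool)} {m : List ℤ} : m ∈ moves C ↔
    ∃ c₁ ∈ ⊥ :: C, ∃ c₂ ∈ ⊥ :: C, ∃ c₃ ∈ ⊥ :: C, ∃ c₄ ∈ ⊥ :: C, move C c₁ c₂ c₃ c₄ = m := by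
  simp only [moves, mem_diffs, rows, List.mem_map]
  constructor
  · rintro ⟨_, ⟨_, ⟨c₁, h1, rfl⟩, _, ⟨c₂, h2, rfl⟩, rfl⟩, _, ⟨_, ⟨c₃, h3, rfl⟩, _, ⟨c₄, h4, rfl⟩,
      rfl⟩, rfl⟩
    exact ⟨c₁, h1, c₂, h2, c₃, h3, c₄, h4, by rw [vsub_row, vsub_row, vsub_row, move]⟩
  · rintro ⟨c₁, h1, c₂, h2, c₃, h3, c₄, h4, rfl⟩
    exact ⟨_, ⟨_, ⟨c₁, h1, rfl⟩, _, ⟨c₂, h2, rfl⟩, rfl⟩, _, ⟨_, ⟨c₃, h3, rfl⟩, _, ⟨c₄, h4, rfl⟩,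
      rfl⟩, by rw [vsub_row, vsub_row, vsub_row, move]⟩

theorem length_of_mem_moves {C : List (Fin n → Bool)} {m : List ℤ} (h : m ∈ moves C) :
    m.length = C.length + 2 * n := by
  obtain ⟨c₁, -, c₂, -, c₃, -, c₄, -, rfl⟩ := mem_moves.1 h
  simp [move]

theorem vsub_state_move (C : List (Fin n → Bool)) (D c₁ c₂ c₃ c₄) :
    vsub (state C D) (move C c₁ c₂ c₃ c₄) =
      row C ((fun c => (D.count c : ℤ)) - (negUnit c₁ - negUnit c₂ - (negUnit c₃ - negUnit c₄)))
        (0 - (bitFun c₁ - bitFun c₂ - (bitFun c₃ - bitFun c₄))) := by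
  rw [state, move, vsub_row]

/-- No compatibility of the four sets is needed: nonnegative multiplicities define a multiset, and
the vanishing of the label part says that its sum is still `g`. -/
theorem isDec_of_move {C : List (Fin n → Bool)} {g : Fin n → ℤ} {x : List ℤ}
    (hx : ∃ D, IsDec C g D ∧ state C D = x) {m : List ℤ} (hm : m ∈ moves C)
    (h : ∀ y ∈ vsub x m, 0 ≤ y) : ∃ D, IsDec C g D ∧ state C D = vsub x m := by
  obtain ⟨D, hD, rfl⟩ := hx
  obtain ⟨c₁, h1, c₂, h2, c₃, h3, c₄, h4, rfl⟩ := mem_moves.1 hm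
  rw [vsub_state_move] at h ⊢
  obtain ⟨hd, ht⟩ := row_nonneg_iff.1 h
  obtain ⟨D', hD', hc⟩ := exists_isDec hd
  refine ⟨D', ⟨hD'.1, hD'.2.trans ?_⟩, row_congr hc ht.symm⟩
  rw [weight_sub, weight_count hD.1, hD.2, weight_sub, weight_sub, weight_sub, weight_negUnit h1,
    weight_negUnit h2, weight_negUnit h3, weight_negUnit h4]
  rw [zero_sub, neg_eq_zero] at ht
  rw [show -bitFun c₁ - -bitFun c₂ - (-bitFun c₃ - -bitFun c₄)
    = -(bitFun c₁ - bitFun c₂ - (bitFun c₃ - bitFun c₄)) by abel, ht, neg_zero, sub_zero]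

theorem state_of_move {C : List (Fin n → Bool)} {D D' : Multiset (Fin n → Bool)}
    {c₁ c₂ c₃ c₄ : Fin n → Bool}
    (hb : bitFun c₁ + bitFun c₄ = bitFun c₂ + bitFun c₃)
    (h : ∀ c ∈ C, (D.count c : ℤ) + (negUnit c₂ c + negUnit c₃ c)
      = D'.count c + (negUnit c₁ c + negUnit c₄ c)) :
    state C D' = vsub (state C D) (move C c₁ c₂ c₃ c₄) := by
  rw [vsub_state_move]
  refine row_congr (fun c hc => ?_) ?_
  · have := h c hc
    simp only [Pi.sub_apply]
    linarith
  · rw [show bitFun c₁ - bitFun c₂ - (bitFun c₃ - bitFun c₄)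
      = bitFun c₁ + bitFun c₄ - (bitFun c₂ + bitFun c₃) by abel, hb, sub_self, sub_zero]

theorem state_nonneg (C : List (Fin n → Bool)) (D) : ∀ y ∈ state C D, 0 ≤ y :=
  row_nonneg_iff.2 ⟨fun _ _ => by positivity, rfl⟩

/-- Covers disjoint sets too: both sides then vanish on `C`, so an exchange has the same four-row
form in every case. -/
theorem count_meet {C : List (Fin n → Bool)} (hC : IsRing C) (c c' : Fin n → Bool)
    {x : Fin n → Bool} (hx : x ∈ C) : ((meet c c').count x : ℤ) = - negUnit (c ⊓ c') x := by
  have : ⊥ ≠ x := fun h => hC.bot (h ▸ hx)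
  unfold meet negUnit
  split_ifs with h1 h2 h2
  · exact absurd (h1.symm.trans h2) this
  · simp
  · simp [h2]
  · simp [Ne.symm h2]

/-- A set of states that is closed under the moves and contains a decomposition contains all
decompositions related to it by exchanges. -/
theorem state_mem_of_addConGen {C : List (Fin n → Bool)} (hC : IsRing C) {X : List (List ℤ)}
    (hX : ∀ x ∈ X, ∀ m ∈ moves C, (∀ y ∈ vsub x m, 0 ≤ y) → vsub x m ∈ X)
    {D D' : Multiset (Fin n → Bool)} (h : addConGen (Exchange C) D D') :
    state C D ∈ X ↔ state C D' ∈ X := by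
  -- Quantifying over a further summand `F` makes the relation a congruence, so it need only be
  -- checked on the generating exchanges.
  let r : AddCon (Multiset (Fin n → Bool)) :=
    { r := fun D D' => ∀ F, state C (F + D) ∈ X ↔ state C (F + D') ∈ X
      iseqv := ⟨fun _ _ => Iff.rfl, fun h F => (h F).symm, fun h h' F => (h F).trans (h' F)⟩
      add' := fun {D₁ D₁' D₂ D₂'} h h' F => by
        rw [← add_assoc, h' (F + D₁), add_right_comm, h (F + D₂'), add_right_comm, add_assoc] }
  have hmove : ∀ D D' : Multiset (Fin n → Bool), ∀ c₁ ∈ ⊥ :: C, ∀ c₂ ∈ ⊥ :: C, ∀ c₃ ∈ ⊥ :: C,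
      ∀ c₄ ∈ ⊥ :: C, bitFun c₁ + bitFun c₄ = bitFun c₂ + bitFun c₃ →
      (∀ c ∈ C, (D.count c : ℤ) + (negUnit c₂ c + negUnit c₃ c)
        = D'.count c + (negUnit c₁ c + negUnit c₄ c)) →
      state C D ∈ X → state C D' ∈ X := by
    intro D D' c₁ h1 c₂ h2 c₃ h3 c₄ h4 hb hc hD
    have e := state_of_move hb hc
    rw [e]
    refine hX _ hD _ (mem_moves.2 ⟨c₁, h1, c₂, h2, c₃, h3, c₄, h4, rfl⟩) ?_
    rw [← e]
    exact state_nonneg C D'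
  have hr : addConGen (Exchange C) ≤ r := by
    refine AddCon.addConGen_le.2 ?_
    rintro _ _ ⟨c, hc, c', hc', rfl, rfl⟩ F
    have h1 : c ∈ ⊥ :: C := List.mem_cons_of_mem _ hc
    have h2 : c' ∈ ⊥ :: C := List.mem_cons_of_mem _ hc'
    have h3 : c ⊔ c' ∈ ⊥ :: C := List.mem_cons_of_mem _ (hC.sup c hc c' hc')
    have h4 : c ⊓ c' ∈ ⊥ :: C := by
      by_cases h : c ⊓ c' = ⊥
      · simp [h]
      · exact List.mem_cons_of_mem _ (hC.inf c hc c' hc' h)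
    have hb := bitFun_sup_add_inf c c'
    have hcount : ∀ x ∈ C, ((F + {c, c'}).count x : ℤ) + (negUnit c x + negUnit c' x)
        = (F + (c ⊔ c') ::ₘ meet c c').count x + (negUnit (c ⊔ c') x + negUnit (c ⊓ c') x) := by
      intro x hx
      have hs (a : Fin n → Bool) : ((if x = a then 1 else 0 : ℕ) : ℤ) = - negUnit a x := by
        unfold negUnit
        simp only [eq_comm (a := x)]
        split_ifs <;> simp
      simp only [Multiset.insert_eq_cons, Multiset.count_add, Multiset.count_cons,
        Multiset.count_singleton, Nat.cast_add, count_meet hC c c' hx, hs]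
      ring
    -- Interchanging the added and the removed sets inverts a move, which gives both directions.
    exact ⟨hmove _ _ _ h3 _ h1 _ h2 _ h4 hb hcount,
      hmove _ _ _ h1 _ h3 _ h4 _ h2 hb.symm fun x hx => (hcount x hx).symm⟩
  simpa using hr h 0

/-! ### The number of decompositions -/

/-- Every nonempty set contributes at least 1 to the sum of all labels. This makes the set of
decompositions finite. -/
theorem card_le_sum_total {D : Multiset (Fin n → Bool)} (hD : ⊥ ∉ D) :
    (D.card : ℤ) ≤ ∑ v, total D v := by
  induction D using Multiset.induction with
  | empty => simp [total]
  | cons c D ih =>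
    have ih := ih fun h => hD (by simp [h])
    obtain ⟨v, hv⟩ := Function.ne_iff.1 (fun h => hD (by simp [h]) : c ≠ ⊥)
    have h1 : 1 ≤ ∑ v, bitFun c v := by
      have hv' : bitFun c v = 1 := by simpa [bitFun] using hv
      rw [← hv']
      exact Finset.single_le_sum (fun w _ => bitFun_nonneg c w) (Finset.mem_univ v)
    rw [total_cons, Multiset.card_cons]
    simp only [Pi.add_apply, Finset.sum_add_distrib]
    push_cast
    linarith

theorem total_le_card (D : Multiset (Fin n → Bool)) (v : Fin n) : total D v ≤ D.card := by
  induction D using Multiset.induction with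
  | empty => simp [total]
  | cons c D ih =>
    have : bitFun c v ≤ 1 := by unfold bitFun; split_ifs <;> simp
    rw [total_cons, Multiset.card_cons, Pi.add_apply]
    push_cast
    linarith

theorem finite_isDec {C : List (Fin n → Bool)} (hC : ⊥ ∉ C) (g : Fin n → ℤ) :
    {D | IsDec C g D}.Finite := by
  refine (Set.finite_Iic ((∑ v, g v).toNat • (Finset.univ : Finset (Fin n → Bool)).val)).subset ?_
  intro D hD
  have h := card_le_sum_total fun h => hC (hD.1 _ h)
  rw [hD.2] at h
  refine Multiset.le_iff_count.2 fun c => (Multiset.count_le_card c D).trans ?_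
  rw [Multiset.count_nsmul, Multiset.count_eq_one_of_mem Finset.univ.nodup (Finset.mem_univ c)]
  omega

/-- The number of decompositions. -/
noncomputable def numDec (C : List (Fin n → Bool)) (g : Fin n → ℤ) : ℕ := {D | IsDec C g D}.ncard

theorem length_le_numDec {C : List (Fin n → Bool)} (hC : ⊥ ∉ C) (g : Fin n → ℤ)
    {l : List (List ℤ)} (hl : l.Nodup) (h : ∀ x ∈ l, ∃ D, IsDec C g D ∧ state C D = x) :
    l.length ≤ numDec C g := by
  have hf := (finite_isDec hC g).image (state C)
  rw [← List.toFinset_card_of_nodup hl, ← Set.ncard_coe_finset]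
  refine (Set.ncard_le_ncard (fun x hx => ?_) hf).trans (Set.ncard_image_le (finite_isDec hC g))
  exact h x (by simpa using hx)

theorem numDec_le_length {C : List (Fin n → Bool)} {g : Fin n → ℤ}
    {l : List (List ℤ)} (h : ∀ D, IsDec C g D → state C D ∈ l) :
    numDec C g ≤ l.length := by
  rw [numDec, ← Set.InjOn.ncard_image (f := state C)
    fun D hD D' hD' h => state_injOn hD.1 hD'.1 h]
  refine (Set.ncard_le_ncard (t := (l.toFinset : Set (List ℤ))) ?_ (Finset.finite_toSet _)).trans ?_
  · rintro _ ⟨D, hD, rfl⟩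
    simpa using h D hD
  · rw [Set.ncard_coe_finset]
    exact List.toFinset_card_le l

/-! ### The decompositions as lists of indices -/

/-- The indices in `C` of the elements of `D`. -/
def positions (C : List (Fin n → Bool)) (D : Multiset (Fin n → Bool)) : List (Fin C.length) :=
  (List.finRange C.length).flatMap fun i => List.replicate (D.count (C.get i)) i

theorem map_get_positions {C : List (Fin n → Bool)} (hC : C.Nodup) {D : Multiset (Fin n → Bool)}
    (hD : ∀ c ∈ D, c ∈ C) : (((positions C D).map C.get : List _) : Multiset (Fin n → Bool)) = D := by
  have e : (positions C D).map C.get = C.flatMap fun c => List.replicate (D.count c) c := by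
    conv_rhs => rw [← List.map_get_finRange C, List.flatMap_map]
    simp only [positions, List.map_flatMap, List.map_replicate]
  rw [e]
  ext c
  rw [Multiset.coe_count, List.count_flatMap]
  have h1 : (List.count c ∘ fun c' => List.replicate (D.count c') c')
      = fun c' => if c' = c then D.count c else 0 := by
    funext c'
    simp only [Function.comp, List.count_replicate, beq_iff_eq]
    split_ifs with h
    · rw [h]
    · rfl
  rw [h1, ← List.sum_toFinset _ hC, Finset.sum_ite_eq']
  split_ifs with h
  · rfl
  · exact (Multiset.count_eq_zero_of_notMem fun h' => h (by simpa using hD c h')).symm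

theorem length_positions {C : List (Fin n → Bool)} (hC : C.Nodup) {D : Multiset (Fin n → Bool)}
    (hD : ∀ c ∈ D, c ∈ C) : (positions C D).length = D.card := by
  conv_rhs => rw [← map_get_positions hC hD]
  simp

theorem indices_eq (i : ℕ) : ∀ a : List ℕ,
    indices i a = (List.finRange a.length).flatMap fun j => List.replicate (a.get j) (i + j)
  | [] => rfl
  | x :: a => by
    rw [indices, indices_eq (i + 1) a]
    simp only [List.length_cons, List.finRange_succ, List.flatMap_cons, List.flatMap_map]
    simp [Nat.add_assoc, Nat.add_comm 1]

/-- The state of `D`, as a list of natural numbers. -/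
def natState (C : List (Fin n → Bool)) (D : Multiset (Fin n → Bool)) : List ℕ :=
  (C.map fun c => D.count c) ++ List.replicate (2 * n) 0

theorem state_eq_map (C : List (Fin n → Bool)) (D : Multiset (Fin n → Bool)) :
    state C D = (natState C D).map (↑) := by
  have h0 : List.ofFn (0 : Fin n → ℤ) = List.replicate n 0 := List.ofFn_const n 0
  simp only [state, row, natState, h0, two_mul, List.map_append, List.map_map, List.map_replicate,
    List.replicate_append_replicate, Function.comp_def, neg_zero, Nat.cast_zero]

/-- The 2n zeros at the end of a state contribute no indices, so they need not be cut off before the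
conversion. -/
theorem indices_append (a : List ℕ) (m : ℕ) : ∀ i, indices i (a ++ List.replicate m 0)
    = indices i a := by
  induction a with
  | nil =>
    induction m with
    | zero => simp
    | succ m ih =>
      intro i
      simpa [List.replicate_succ, indices] using ih (i + 1)
  | cons x a ih => intro i; simp [indices, ih]

theorem indices_natState (C : List (Fin n → Bool)) (D : Multiset (Fin n → Bool)) :
    indices 0 (natState C D) = (positions C D).map (fun i : Fin C.length => (i : ℕ)) := by
  rw [natState, indices_append, indices_eq, positions, List.map_flatMap]
  have : ∀ k (h : k = C.length) (f : Fin k → List ℕ), (List.finRange k).flatMap f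
      = (List.finRange C.length).flatMap fun i => f (i.cast h.symm) := by
    rintro _ rfl f; rfl
  rw [this _ (by simp)]
  simp

/-! ### The running time -/

def tDiffs (a m : ℕ) : ℕ := (a + 1) * ((a + 1) * (tVec m + 40) + 40)

/-- The total time for `n` nodes, `e` edges, `k` components, `N` decompositions, and
multiplicities and labels up to `M`. -/
def tMain (n e k N M : ℕ) : ℕ :=
  (e + 1) * (2 * tVec n + 40) + tClosures e n + tComps k n + tVec n + tRows k n +
    tDiffs (k + 1) (k + 2 * n) + tDiffs ((k + 1) ^ 2) (k + 2 * n) + (M + 1) * tChain k n +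
    (N + 2) * (tExpand ((k + 1) ^ 4) N (k + 2 * n) + 60) +
    (N + 1) * (tIndices M (k + 2 * n) + 40) + 200

theorem tMain_mono {n e k N M n' e' k' N' M' : ℕ} (h1 : n ≤ n') (h2 : e ≤ e') (h3 : k ≤ k')
    (h4 : N ≤ N') (h5 : M ≤ M') : tMain n e k N M ≤ tMain n' e' k' N' M' := by
  simp only [tMain, tClosures, tComps, tRows, tDiffs, tChain, tExpand, tIndices, tAdd, tExtend,
    tRow, tMem, tEq, tVec]
  gcongr

def IsPoly (f : ℕ → ℕ) : Prop := ∃ p : Polynomial ℕ, ∀ x, f x = p.eval x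

namespace IsPoly

theorem const (c : ℕ) : IsPoly fun _ => c := ⟨.C c, by simp⟩

theorem id : IsPoly fun x => x := ⟨.X, by simp⟩

theorem add {f g : ℕ → ℕ} (hf : IsPoly f) (hg : IsPoly g) : IsPoly fun x => f x + g x := by
  obtain ⟨p, hp⟩ := hf
  obtain ⟨q, hq⟩ := hg
  exact ⟨p + q, by simp [hp, hq]⟩

theorem mul {f g : ℕ → ℕ} (hf : IsPoly f) (hg : IsPoly g) : IsPoly fun x => f x * g x := by
  obtain ⟨p, hp⟩ := hf
  obtain ⟨q, hq⟩ := hg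
  exact ⟨p * q, by simp [hp, hq]⟩

theorem pow {f : ℕ → ℕ} (hf : IsPoly f) (m : ℕ) : IsPoly fun x => f x ^ m := by
  obtain ⟨p, hp⟩ := hf
  exact ⟨p ^ m, by simp [hp]⟩

end IsPoly

variable {f g h : ℕ → ℕ}

theorem IsPoly.tVec (hf : IsPoly f) : IsPoly fun x => tVec (f x) :=
  (hf.add (const 1)).mul (const 40)

theorem IsPoly.tEq (hf : IsPoly f) : IsPoly fun x => tEq (f x) :=
  ((const 4).mul hf.tVec).add (const 30)

theorem IsPoly.tMem (hf : IsPoly f) (hg : IsPoly g) : IsPoly fun x => tMem (f x) (g x) :=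
  (hf.add (const 1)).mul (hg.tEq.add (const 30))

theorem IsPoly.tAdd (hf : IsPoly f) (hg : IsPoly g) : IsPoly fun x => tAdd (f x) (g x) :=
  (hf.add (const 1)).mul (((const 2).mul hg.tVec).add (const 60))

theorem IsPoly.tClosures (hf : IsPoly f) (hg : IsPoly g) :
    IsPoly fun x => tClosures (f x) (g x) :=
  (hf.add (const 1)).mul (((((const 2).mul (hg.tAdd hg)).add ((const 5).mul hg.tVec)).add
    (const 100)).add ((hg.add (const 1)).mul (hg.tVec.add (const 40))))

theorem IsPoly.tExtend (hf : IsPoly f) (hg : IsPoly g) : IsPoly fun x => tExtend (f x) (g x) :=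
  (hf.add (const 1)).mul (((hf.tMem hg).add hg.tVec).add (const 60))

theorem IsPoly.tComps (hf : IsPoly f) (hg : IsPoly g) : IsPoly fun x => tComps (f x) (g x) :=
  (hg.add (const 1)).mul (((hf.tExtend hg).add ((const 2).mul hg.tVec)).add (const 60))

theorem IsPoly.tRow (hf : IsPoly f) (hg : IsPoly g) : IsPoly fun x => tRow (f x) (g x) :=
  (hf.add (const 1)).mul ((hg.tEq.add hg.tVec).add (const 60))

theorem IsPoly.tRows (hf : IsPoly f) (hg : IsPoly g) : IsPoly fun x => tRows (f x) (g x) :=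
  (hf.add (const 2)).mul ((hf.tRow hg).add (const 40))

theorem IsPoly.tDiffs (hf : IsPoly f) (hg : IsPoly g) : IsPoly fun x => tDiffs (f x) (g x) :=
  (hf.add (const 1)).mul (((hf.add (const 1)).mul (hg.tVec.add (const 40))).add (const 40))

theorem IsPoly.tChain (hf : IsPoly f) (hg : IsPoly g) : IsPoly fun x => tChain (f x) (g x) :=
  (((hf.add ((const 2).mul hg)).tVec.add ((const 4).mul hg.tVec)).add
    ((const 2).mul (hf.tRow hg))).add (const 100)

theorem IsPoly.tExpand (hf : IsPoly f) (hg : IsPoly g) (hh : IsPoly h) :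
    IsPoly fun x => tExpand (f x) (g x) (h x) :=
  (hf.add (const 1)).mul ((((const 2).mul hh.tVec).add (hg.tMem hh)).add (const 80))

theorem IsPoly.tIndices (hf : IsPoly f) (hg : IsPoly g) : IsPoly fun x => tIndices (f x) (g x) :=
  (hg.add (const 1)).mul (((hf.add (const 1)).mul (const 30)).add (const 40))

/-- All parameters are bounded by the size `S`, except for the number of decompositions, which may
be one larger because an empty decomposition has size 0. -/
theorem isPoly_tMain : IsPoly fun S => tMain S S S (S + 1) S := by
  have hS := IsPoly.id
  have hm := hS.add ((IsPoly.const 2).mul hS)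
  have hS1 := hS.add (.const 1)
  exact (((((((((((hS1.mul (((IsPoly.const 2).mul hS.tVec).add (.const 40))).add
    (hS.tClosures hS)).add (hS.tComps hS)).add hS.tVec).add (hS.tRows hS)).add
    (hS1.tDiffs hm)).add ((hS1.pow 2).tDiffs hm)).add (hS1.mul (hS.tChain hS))).add
    ((hS1.add (.const 2)).mul (((hS1.pow 4).tExpand hS1 hm).add (.const 60)))).add
    ((hS1.add (.const 1)).mul ((hS.tIndices hm).add (.const 40)))).add (.const 200))

/-! ### The main function -/

theorem Std.of_good {E : List (Fin n × Fin n)} {g : Fin n → ℤ} {c : Fin n → Bool}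
    (h : Good E g c) : Std E g := by
  have := h.1.add h.2
  rwa [add_sub_cancel] at this

theorem isRing_comps {E : List (Fin n × Fin n)} {g : Fin n → ℤ} (hg : Std E g) :
    IsRing (comps g (List.ofFn (closures g E))) where
  bot h := ((mem_comps_iff hg).1 h).2 rfl
  sup c h c' h' := by
    rw [mem_comps_iff hg] at *
    exact ⟨good_sup hg h.1 h'.1, fun e => h.2 (sup_eq_bot_iff.1 e).1⟩
  inf c h c' h' hne := by
    rw [mem_comps_iff hg] at *
    exact ⟨good_inf hg h.1 h'.1, hne⟩

theorem main_run_of_not_std {E : List (Fin n × Fin n)} {g : Fin n → ℤ} (hg : ¬ Std E g) :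
    FunLe prog 0 (.cons (vec (List.ofFn g)) (edges E)) (.cons .nil .nil)
      (tMain n E.length 0 0 0) := by
  have h := (std_run g E).of (w := .int 0) (by rw [if_neg]; exact hg) le_rfl
  exact ⟨_, rfl, (EvalLe.split (.var rfl) (.ifLt_neg .lit (.call h (.cons (.var rfl) (.var rfl)))
    (by decide) (.cons .nil .nil))).of rfl (by unfold tMain; omega)⟩

theorem exists_map_eq {α β : Type*} {f : α → β} {p : α → Prop} : ∀ {l : List β},
    (∀ y ∈ l, ∃ x, p x ∧ f x = y) → ∃ l' : List α, (∀ x ∈ l', p x) ∧ l'.map f = l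
  | [], _ => ⟨[], by simp⟩
  | y :: l, h => by
    obtain ⟨x, hx, rfl⟩ := h y (by simp)
    obtain ⟨l', h1, rfl⟩ := exists_map_eq (p := p) (f := f) fun y hy => h y (List.mem_cons_of_mem _ hy)
    exact ⟨x :: l', by simpa using ⟨hx, h1⟩, rfl⟩

theorem main_run {E : List (Fin n × Fin n)} {g : Fin n → ℤ} (hg : Std E g) {M : ℕ}
    (hM : ∀ v, g v ≤ M) (hM' : ∀ D, IsDec (comps g (List.ofFn (closures g E))) g D → D.card ≤ M) :
    ∃ L : List (Multiset (Fin n → Bool)), L.Nodup ∧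
      (∀ D, D ∈ L ↔ IsDec (comps g (List.ofFn (closures g E))) g D) ∧
      FunLe prog 0 (.cons (vec (List.ofFn g)) (edges E))
        (.cons (mat ((comps g (List.ofFn (closures g E))).map bits))
          (mat ((L.map fun D => (positions (comps g (List.ofFn (closures g E))) D).map
            fun i : Fin _ => ((i : ℕ) : ℤ)))))
        (tMain n E.length (comps g (List.ofFn (closures g E))).length L.length M) := by
  have hC := isRing_comps hg
  have hmem := fun c => mem_comps_iff hg (c := c)
  have hcl := closures_run g E
  have hco := comps_run g (List.ofFn (closures g E)) le_rfl
  set C := comps g (List.ofFn (closures g E)) with hCdef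
  clear_value C
  have hstd := (std_run g E).of (w := .int 1) (by rw [if_pos]; exact hg) le_rfl
  have hzero : FunLe prog 7 (.cons (.int (-1)) (vec (List.ofFn g))) (vec (bits (⊥ : Fin n → Bool)))
      (tVec n) := by
    refine (unit_run (-1) ((List.ofFn g).map .int)).of ?_ (by simp)
    congr 1
    refine List.ext_getElem (by simp) fun i _ _ => ?_
    simp [bits]
  have hrows := rows_run C (⊥ :: C)
  have hlen : ∀ r ∈ rows C (⊥ :: C), r.length = C.length + 2 * n := by
    intro r hr
    obtain ⟨c, -, rfl⟩ := List.mem_map.1 hr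
    simp
  have hd1 := diffs_run _ hlen _ hlen
  have hlen' : ∀ r ∈ diffs (rows C (⊥ :: C)) (rows C (⊥ :: C)), r.length = C.length + 2 * n := by
    intro r hr
    obtain ⟨a, ha, b, hb, rfl⟩ := mem_diffs.1 hr
    rw [length_vsub (by rw [hlen a ha, hlen b hb]), hlen a ha]
  have hd2 := diffs_run _ hlen' _ hlen'
  obtain ⟨D₀, hD₀, hchain⟩ := chain_run hC.bot g M g hg.1 hM
  have hzero' : Std E (g - g) := by
    rw [sub_self]
    exact ⟨fun _ => le_rfl, fun _ _ => le_rfl⟩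
  have hdec₀ : IsDec C g D₀ := ⟨hD₀.mem hmem hg hzero', hD₀.total⟩
  rw [sub_self] at hchain
  change FunLe prog 22 _ (vec (state C D₀)) _ at hchain
  have hVlen : ∀ x, (∃ D, IsDec C g D ∧ state C D = x) → x.length = C.length + 2 * n := by
    rintro _ ⟨D, -, rfl⟩
    simp [state]
  -- The search runs inside the set of states of decompositions, with their number as the bound `N`.
  obtain ⟨out, hs, hnodup, hV, hstart, hclosed⟩ := search_run (moves C)
    (fun m hm => length_of_mem_moves hm) (fun x => ∃ D, IsDec C g D ∧ state C D = x) hVlen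
    (fun l hl h => length_le_numDec hC.bot g hl h) (fun x hx m hm h => isDec_of_move hx hm h) _
    [state C D₀] [state C D₀] (List.nodup_singleton _) (by simpa using ⟨D₀, hdec₀, rfl⟩)
    (by simp) (by simp) rfl
  -- Each decomposition is linked by exchanges to the chain at which the search starts.
  have hall : ∀ D, IsDec C g D → state C D ∈ out := fun D hD =>
    (state_mem_of_addConGen hC hclosed (hD₀.addConGen hC D hD.1 hD.2)).2 (hstart _ (by simp))
  have hN : numDec C g = out.length :=
    le_antisymm (numDec_le_length hall) (length_le_numDec hC.bot g hnodup hV)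
  obtain ⟨L, hL, rfl⟩ := exists_map_eq hV
  have hind := allIndices_run (M := M) (m := C.length + 2 * n) (L.map (natState C))
    (by simp [natState]) (by
      intro a ha x hx
      obtain ⟨D, hD, rfl⟩ := List.mem_map.1 ha
      rcases List.mem_append.1 hx with hx | hx
      · obtain ⟨c, -, rfl⟩ := List.mem_map.1 hx
        exact (Multiset.count_le_card c D).trans (hM' D (hL D hD))
      · rw [List.eq_of_mem_replicate hx]
        exact Nat.zero_le _)
  have e1 : (L.map (natState C)).map (List.map ((↑) : ℕ → ℤ)) = L.map (state C) := by
    simp [state_eq_map, Function.comp_def]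
  have e2 : ((L.map (natState C)).map (indices 0)).map (List.map ((↑) : ℕ → ℤ))
      = L.map fun D => (positions C D).map fun i : Fin _ => ((i : ℕ) : ℤ) := by
    simp [indices_natState, Function.comp_def]
  rw [e1, e2] at hind
  have hLmem : ∀ D, D ∈ L ↔ IsDec C g D := fun D => ⟨hL D, fun hD => by
    obtain ⟨D', h1, h2⟩ := List.mem_map.1 (hall D hD)
    rwa [state_injOn hD.1 (hL D' h1).1 h2.symm]⟩
  refine ⟨L, hnodup.of_map _, hLmem, _, rfl, (EvalLe.split (.var rfl) (.ifLt_pos .lit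
    (.call hstd (.cons (.var rfl) (.var rfl))) one_pos
    (.bind (.call hco (.cons (.var rfl) (.call hcl (.cons (.var rfl) (.var rfl)))))
    (.bind (.call hrows (.cons (.var rfl) (.cons (.call hzero (.cons .lit (.var rfl))) (.var rfl))))
    (.bind (.call hd1 (.cons (.var rfl) (.var rfl)))
    (.bind (.call hd2 (.cons (.var rfl) (.var rfl)))
    (.bind (.call hchain (.cons (.cons (.var rfl) (.var rfl)) (.var rfl)))
    (.cons (.var rfl) (.call hind (.cons .nil (.call hs (.cons (.var rfl)
      (.cons (.cons (.var rfl) .nil) (.cons (.var rfl) .nil)))))))))))))).of rfl ?_⟩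
  have hpos : 1 ≤ L.length := List.length_pos_of_mem ((hLmem D₀).2 hdec₀)
  rw [hN, length_moves]
  simp only [length_diffs, List.length_map, List.length_cons, rows, List.length_nil,
    List.length_ofFn, tMain, tDiffs, tRows, tComps]
  rw [show L.length - (0 + 1) + (0 + 1) + 1 = L.length + 1 by omega,
    show (C.length + 1) * (C.length + 1) = (C.length + 1) ^ 2 by ring,
    show C.length + 1 + 1 = C.length + 2 from rfl]
  have h2 : (L.length + 1) * (tExpand ((C.length + 1) ^ 4) L.length (C.length + 2 * n) + 60)
      ≤ (L.length + 2) * (tExpand ((C.length + 1) ^ 4) L.length (C.length + 2 * n) + 60) := by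
    gcongr; omega
  omega

/-! ### Labeled graphs -/

theorem isStandard_iff {G H : LabeledGraph (Fin n)} {E : List (Fin n × Fin n)}
    (hE : G.IsEdgeList E) (hH : ∀ a b, H.graph.Adj a b ↔ G.graph.Adj a b) :
    H.IsStandard ↔ Std E H.label := by
  simp only [LabeledGraph.IsStandard, Std, Prod.forall, hE.2, hH]

theorem isStandard_ofBits {G : LabeledGraph (Fin n)} {E : List (Fin n × Fin n)}
    (hE : G.IsEdgeList E) (c : Fin n → Bool) :
    ((G.ofBits c).IsStandard ∧ (G - G.ofBits c).IsStandard) ↔ Good E G.label c :=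
  -- The edge set of the difference is the union of two copies of the same edge set.
  and_congr (isStandard_iff hE fun _ _ => Iff.rfl) (isStandard_iff hE fun _ _ => or_self_iff)

theorem ofBits_injective (G : LabeledGraph (Fin n)) : Function.Injective G.ofBits := by
  intro c c' h
  exact bits_injective (congrArg (fun H : LabeledGraph (Fin n) => List.ofFn H.label) h)

theorem isStandardComponent_iff {G H : LabeledGraph (Fin n)} {E : List (Fin n × Fin n)}
    (hE : G.IsEdgeList E) :
    G.IsStandardComponent H ↔ ∃ c, (Good E G.label c ∧ c ≠ ⊥) ∧ G.ofBits c = H := by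
  constructor
  · intro h
    have e : G.ofBits (fun v => decide (H.label v = 1)) = H := by
      refine LabeledGraph.ext h.graph_eq.symm (funext fun v => ?_)
      rcases h.isZeroOne v with h | h <;> simp [LabeledGraph.ofBits, h]
    refine ⟨_, ⟨(isStandard_ofBits hE _).1 (by rw [e]; exact ⟨h.isStandard, h.sub_isStandard⟩),
      fun h0 => ?_⟩, e⟩
    obtain ⟨v, hv⟩ := h.ne_zero
    have := congrFun h0 v
    simp only [Pi.bot_apply] at this
    exact (h.isZeroOne v).elim hv (of_decide_eq_false this)
  · rintro ⟨c, ⟨h1, h2⟩, rfl⟩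
    obtain ⟨h3, h4⟩ := (isStandard_ofBits hE c).2 h1
    obtain ⟨v, hv⟩ := Function.ne_iff.1 h2
    refine ⟨rfl, fun v => ?_, h3, h4, v, ?_⟩
    · simp only [LabeledGraph.ofBits]
      split_ifs <;> simp
    · simpa [LabeledGraph.ofBits] using hv

theorem sumOn_map_ofBits (G : LabeledGraph (Fin n)) (D : Multiset (Fin n → Bool)) :
    G.sumOn (D.map G.ofBits) = G ↔ total D = G.label := by
  have h : (G.sumOn (D.map G.ofBits)).label = total D := by
    funext v
    simp only [LabeledGraph.sumOn, Multiset.map_map, total]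
    induction D using Multiset.induction with
    | empty => simp
    | cons c D ih =>
      simp only [Multiset.map_cons, Multiset.sum_cons, Pi.add_apply, ← ih]
      rfl
  exact ⟨fun e => by rw [← h, e], fun e => LabeledGraph.ext rfl (h.trans e)⟩

theorem mem_decom_iff {G : LabeledGraph (Fin n)} {E : List (Fin n × Fin n)} (hE : G.IsEdgeList E)
    {C : List (Fin n → Bool)} (hC : ∀ c, c ∈ C ↔ Good E G.label c ∧ c ≠ ⊥)
    (D : Multiset (LabeledGraph (Fin n))) :
    D ∈ G.decom ↔ ∃ D₀, IsDec C G.label D₀ ∧ D₀.map G.ofBits = D := by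
  constructor
  · rintro ⟨h1, h2⟩
    have h3 : ∀ H ∈ D, ∃ c ∈ C, G.ofBits c = H := fun H hH => by
      obtain ⟨c, h, e⟩ := (isStandardComponent_iff hE).1 (h1 H hH)
      exact ⟨c, (hC c).2 h, e⟩
    obtain ⟨l, rfl⟩ := Quot.exists_rep D
    obtain ⟨l', h4, h5⟩ := exists_map_eq h3
    have h5' : (l' : Multiset (Fin n → Bool)).map G.ofBits = l := by
      rw [Multiset.map_coe, h5]
    exact ⟨l', ⟨h4, (sumOn_map_ofBits G _).1 (by rw [h5']; exact h2)⟩, h5'⟩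
  · rintro ⟨D₀, ⟨h1, h2⟩, rfl⟩
    refine ⟨fun H hH => ?_, (sumOn_map_ofBits G _).2 h2⟩
    obtain ⟨c, hc, rfl⟩ := Multiset.mem_map.1 hH
    exact (isStandardComponent_iff hE).2 ⟨c, (hC c).1 (h1 c hc), rfl⟩

/-! ### Correctness and size of the output -/

theorem input_eq (G : LabeledGraph (Fin n)) (E : List (Fin n × Fin n)) :
    G.input E = .cons (vec (List.ofFn G.label)) (edges E) := by
  simp only [LabeledGraph.input, edges, vec, List.map_ofFn]
  rfl

theorem runs_of_funLe {P : Program} {x y : Val} {B : ℕ} (h : FunLe P 0 x y B) :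
    ∃ t ≤ B + 2, Runs P x y t :=
  (EvalLe.call h (ρ := [x]) (.var rfl)).of rfl (by omega)

/-- A component would make G standard, as the sum of the component and its complement. Only the
empty multiset could then be a decomposition, but its sum is zero, which is standard. -/
theorem isCorrect_of_not_std {G : LabeledGraph (Fin n)} {E : List (Fin n × Fin n)}
    (hE : G.IsEdgeList E) (hg : ¬ Std E G.label) : Output.IsCorrect ⟨[], []⟩ G := by
  have h0 : ∀ H, ¬ G.IsStandardComponent H := fun H hH => by
    obtain ⟨c, hc, -⟩ := (isStandardComponent_iff hE).1 hH
    exact hg (Std.of_good hc.1)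
  refine ⟨by simp, fun H => by simpa using h0 H, by simp [Output.multisets], fun D => ?_⟩
  simp only [Output.multisets, List.map_nil, List.not_mem_nil, false_iff]
  rintro ⟨h1, h2⟩
  obtain rfl := Multiset.eq_zero_of_forall_notMem fun H hH => h0 H (h1 H hH)
  have : total (0 : Multiset (Fin n → Bool)) = G.label := (sumOn_map_ofBits G 0).1 (by simpa using h2)
  refine hg ?_
  rw [← this]
  exact ⟨fun _ => le_rfl, fun _ _ => le_rfl⟩

theorem multisets_eq (G : LabeledGraph (Fin n)) {C : List (Fin n → Bool)} (hC : C.Nodup)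
    {L : List (Multiset (Fin n → Bool))} (hL : ∀ D ∈ L, ∀ c ∈ D, c ∈ C) :
    Output.multisets ⟨C, L.map (positions C)⟩ G = L.map (Multiset.map G.ofBits) := by
  simp only [Output.multisets, List.map_map]
  refine List.map_congr_left fun D hD => ?_
  conv_rhs => rw [← map_get_positions hC (hL D hD)]
  simp [Function.comp_def]

theorem isCorrect_of_std {G : LabeledGraph (Fin n)} {E : List (Fin n × Fin n)}
    (hE : G.IsEdgeList E) {C : List (Fin n → Bool)} (hC : C.Nodup)
    (hmem : ∀ c, c ∈ C ↔ Good E G.label c ∧ c ≠ ⊥) {L : List (Multiset (Fin n → Bool))}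
    (hL : L.Nodup) (hLmem : ∀ D, D ∈ L ↔ IsDec C G.label D) :
    Output.IsCorrect ⟨C, L.map (positions C)⟩ G := by
  have e := multisets_eq G hC fun D hD => ((hLmem D).1 hD).1
  refine ⟨hC.map (ofBits_injective G), fun H => ?_, ?_, fun D => ?_⟩
  · simp only [List.mem_map, hmem, isStandardComponent_iff hE]
  · rw [e]
    exact hL.map (Multiset.map_injective (ofBits_injective G))
  · rw [e, mem_decom_iff hE hmem]
    simp only [List.mem_map, hLmem]

theorem length_le_sum_card : ∀ {L : List (Multiset (Fin n → Bool))}, L.Nodup →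
    L.length ≤ (L.map Multiset.card).sum + 1
  | [], _ => by simp
  | D :: L, h => by
    rw [List.nodup_cons] at h
    simp only [List.length_cons, List.map_cons, List.sum_cons]
    by_cases h0 : D = 0
    · subst h0
      -- The list has no duplicates, so the multisets after an empty one all have at least one
      -- element.
      have : (L.map fun _ => 1).sum ≤ (L.map Multiset.card).sum :=
        List.sum_le_sum fun D hD => Multiset.card_pos.2 fun e => h.1 (e ▸ hD)
      simp at this ⊢
      exact this
    · have := length_le_sum_card h.2
      have := Multiset.card_pos.2 h0
      omega

theorem toVal_eq (C : List (Fin n → Bool)) (L : List (Multiset (Fin n → Bool))) :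
    Output.toVal ⟨C, L.map (positions C)⟩ = .cons (mat (C.map bits))
      (mat (L.map fun D => (positions C D).map fun i : Fin _ => ((i : ℕ) : ℤ))) := by
  have h (c : Fin n → Bool) :
      Val.ofList (List.ofFn fun v => .int (if c v then 1 else 0)) = vec (bits c) := by
    simp only [vec, bits, List.map_ofFn]
    rfl
  have h' (l : List (Fin C.length)) : vec (l.map fun i : Fin _ => ((i : ℕ) : ℤ))
      = Val.ofList (l.map fun i : Fin _ => .int (i : ℕ)) := by
    simp only [vec, List.map_map]
    rfl
  simp only [Output.toVal, mat, h, h', List.map_map, Function.comp_def, bind_pure_comp,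
    List.map_eq_map]

theorem size_eq {C : List (Fin n → Bool)} (hC : C.Nodup)
    {L : List (Multiset (Fin n → Bool))} (hL : ∀ D ∈ L, ∀ c ∈ D, c ∈ C) :
    Output.size ⟨C, L.map (positions C)⟩ = n * C.length + (L.map Multiset.card).sum := by
  simp only [Output.size, List.map_map]
  congr 2
  exact List.map_congr_left fun D hD => length_positions hC (hL D hD)

/-- If n = 0, the only set of nodes is empty, so there are no components. -/
theorem length_le_mul {C : List (Fin n → Bool)} (hC : ⊥ ∉ C) : C.length ≤ n * C.length := by
  rcases Nat.eq_zero_or_pos n with rfl | h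
  · have : C = [] := List.eq_nil_iff_forall_not_mem.2 fun c hc => hC (by
      rwa [Subsingleton.elim ⊥ c])
    simp [this]
  · exact Nat.le_mul_of_pos_left _ h

end Decomp

open Decomp in
theorem mainTheorem1 :
    ∃ (P : Program) (p : Polynomial ℕ),
      ∀ (n : ℕ) (G : LabeledGraph (Fin n)) (E : List (Fin n × Fin n)), G.IsEdgeList E →
        ∃ (O : Output n) (t : ℕ),
          O.IsCorrect G ∧
          Runs P (G.input E) O.toVal t ∧
          t ≤ p.eval ((n + E.length) + O.size) := by
  obtain ⟨p, hp⟩ := isPoly_tMain.add (.const 2)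
  refine ⟨prog, p, fun n G E hE => ?_⟩
  rw [input_eq]
  by_cases hg : Std E G.label
  · have hmem := fun c => mem_comps_iff hg (c := c)
    have hnd := nodup_comps G.label (List.ofFn (closures G.label E))
    have hbot := (isRing_comps hg).bot
    have hfin := finite_isDec hbot G.label
    set C := comps G.label (List.ofFn (closures G.label E)) with hCdef
    let M := hfin.toFinset.sup Multiset.card
    have hM : ∀ D, IsDec C G.label D → D.card ≤ M := fun D hD =>
      Finset.le_sup (f := Multiset.card) (hfin.mem_toFinset.2 hD)
    -- A bound by the output requires some decomposition. The chain supplies one, with the sum of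
    -- all labels as a crude bound on the number of rounds; its cardinality is at least every label.
    have hlabel : ∀ v, G.label v ≤ M := by
      have hB : ∀ v, G.label v ≤ (∑ v, G.label v).toNat := fun v => by
        have := Finset.single_le_sum (f := G.label) (fun w _ => hg.1 w) (Finset.mem_univ v)
        omega
      obtain ⟨D, hD, -⟩ := chain_run hbot G.label _ G.label hg.1 hB
      have hdec : IsDec C G.label D := ⟨hD.mem hmem hg (by
        rw [sub_self]
        exact ⟨fun _ => le_rfl, fun _ _ => le_rfl⟩), hD.total⟩
      intro v
      rw [← hdec.2]
      exact (total_le_card D v).trans (by exact_mod_cast hM D hdec)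
    obtain ⟨L, hL, hLmem, hrun⟩ := main_run hg hlabel hM
    rw [← hCdef] at hrun
    have hLC : ∀ D ∈ L, ∀ c ∈ D, c ∈ C := fun D hD => ((hLmem D).1 hD).1
    obtain ⟨t, ht, h⟩ := runs_of_funLe hrun
    rw [← toVal_eq] at h
    refine ⟨_, t, isCorrect_of_std hE hnd hmem hL hLmem, h, ht.trans ?_⟩
    rw [← hp, size_eq hnd hLC]
    have h1 := length_le_mul hbot
    have h2 := length_le_sum_card hL
    -- The largest cardinality is one of the summands of the output size.
    have h3 : M ≤ (L.map Multiset.card).sum := Finset.sup_le fun D hD =>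
      List.single_le_sum (fun _ _ => Nat.zero_le _) _
        (List.mem_map.2 ⟨D, (hLmem D).2 (hfin.mem_toFinset.1 hD), rfl⟩)
    exact Nat.add_le_add_right (tMain_mono (by omega) (by omega) (by omega) (by omega) (by omega)) 2
  · obtain ⟨t, ht, h⟩ := runs_of_funLe (main_run_of_not_std hg)
    refine ⟨⟨[], []⟩, t, isCorrect_of_not_std hE hg, h, ht.trans ?_⟩
    rw [← hp]
    exact Nat.add_le_add_right (tMain_mono (by omega) (by omega) (Nat.zero_le _) (Nat.zero_le _)
      (Nat.zero_le _)) 2
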